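/- Let $Q$ be a smooth manifold of dimension $n=m+k$, let $L:TQ\to\mathbb R$ be smooth, and let $M\subseteq TQ$ be a smooth submanifold of codimension $m$, locally the common zero set of $m$ smooth functions $\Phi^1,\dots,\Phi^m$ with independent differentials along $M$. Assume the admissibility condition $\dim (T_xM)^\circ=\dim S^*\big((T_xM)^\circ\big)$ for all $x\in M$, where $(T_xM)^\circ\subseteq T_x^*(TQ)$ is the annihilator and $S=dq^A\otimes\partial/\partial\dot q^A$ is the canonical vertical endomorphism. Write $\tilde L=L|_M$. Indices run over $1\le A\le n$, $1\le\alpha,\beta\le m$, $m+1\le a\le n$, and repeated indices are summed. Let $W_0=T^*Q\times_QM$ be the set of points of $T^*Q\oplus TQ$ whose $TQ$-component lies in $M$, with projections $\pi_1:W_0\to T^*Q$ and $\pi_2:W_0\to M$. Let $\omega=\pi_1^*\omega_Q$, where $\omega_Q=-d\theta_Q$ is the canonical symplectic form of $T^*Q$ (locally $dq^A\wedge dp_A$), and let $H_{W_0}=\langle\pi_1,\pi_2\rangle-\pi_2^*\tilde L$. Let $W_1\subseteq W_0$ be the set of points $w$ at which the equation $$i_X\omega=dH_{W_0}\qquad(\ast)$$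 has a solution $X\in T_wW_0$. Then: 1. Around every point of $M$ there are coordinates $q^A$ on $Q$ and an open set $U\subseteq TQ$ over their domain such that $M\cap U$ is a graph $\dot q^\alpha=\Psi^\alpha(q^A,\dot q^a)$, where $\Psi$ is smooth on the open set of the values of $(q^A,\dot q^a)$ on $M\cap U$. 2. $W_1=\{w\in W_0 : dH_{W_0}(w)(V)=0 \text{ for all } V\in\ker\omega(w)\}$. For any coordinates as in 1, a point of $W_0$ over $U$ lies in $W_1$ if and only if $$p_a=\frac{\partial\tilde L}{\partial\dot q^a}-p_\alpha\frac{\partial\Psi^\alpha}{\partial\dot q^a}\quad\text{for all } a,$$ where $\tilde L$ is regarded as a function of $(q^A,\dot q^a)$. 3. Fix coordinates as in 1 and a nondegenerate interval $J\subseteq\mathbb R$. For a curve $c$ in $Q$ with coordinates $q^A(t)$ and functions $\mu_\alpha(t)$ on $J$, consider the vakonomic equations $$\frac{d}{dt}\frac{\partial\tilde L}{\partial\dot q^a}-\frac{\partial\tilde L}{\partial q^a}=\mu_\alpha\Big[\frac{d}{dt}\frac{\partial\Psi^\alpha}{\partial\dot q^a}-\frac{\partial\Psi^\alpha}{\partial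 q^a}\Big]+\dot\mu_\alpha\frac{\partial\Psi^\alpha}{\partial\dot q^a},\quad \dot\mu_\alpha=\frac{\partial\tilde L}{\partial q^\alpha}-\mu_\beta\frac{\partial\Psi^\beta}{\partial q^\alpha},\quad \dot q^\alpha=\Psi^\alpha(q^A,\dot q^a),$$ where a solution is understood to have $c$ twice differentiable, $\mu$ differentiable, and $(q^A,\dot q^a)$ in the domain of $\Psi$. A curve $w:J\to W_0$ over $U$ is called an integral curve of $(\ast)$ if it is differentiable and, for every $t\in J$, its velocity $X=\dot w(t)$ solves $(\ast)$ at $w(t)$. Such a $w$, with base curve $c$, is an integral curve of $(\ast)$ if and only if $\pi_2(w(t))=\dot c(t)$ for all $t\in J$, $w$ lies in $W_1$ (that is, satisfies the equations for $p_a$ in 2), and $c$ together with $\mu_\alpha=p_\alpha$ satisfies the vakonomic equations. In particular, if a vector field $X$ solves $(\ast)$ at the points of a subset $S\subseteq W_0$, every integral curve of $X$ in $S$ over $U$ lies in $W_1$ and satisfies the vakonomic equations with $\mu_\alpha=p_\alpha$. Conversely, for every solution $(c,\mu)$ of the vakonomic equations on $J$ with $c$ in the domain of the coordinates $q^A$,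 there is exactly one integral curve $w$ of $(\ast)$ on $J$ with $\pi_2\circ w=\dot c$ and $p_\alpha\circ w=\mu_\alpha$. -/

import Mathlib

open Set Filter Topology Bundle
open scoped Manifold ContDiff

noncomputable section

namespace Vakonomic

/-! ### General notions on a manifold without boundary -/

section General

variable {E H N : Type*} [NormedAddCommGroup E] [NormedSpace ℝ E] [TopologicalSpace H]
  (I : ModelWithCorners ℝ E H) [TopologicalSpace N] [ChartedSpace H N] [IsManifold I 1 N]

/-- The tangent vectors at `x` to a subset `S` of a manifold: the velocities at time `0` of the
smooth curves through `x` that stay in `S` for small times. When `S` is a submanifold this is its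
tangent space `T_x S`, seen inside `T_x N`. -/
def tangentVectors (S : Set N) (x : N) : Set (TangentSpace I x) :=
  {ξ | ∃ γ : ℝ → N, ContMDiffAt 𝓘(ℝ, ℝ) I ∞ γ 0 ∧ (∀ᶠ t in 𝓝 (0 : ℝ), γ t ∈ S) ∧
    (⟨γ 0, mfderiv 𝓘(ℝ, ℝ) I γ 0 (1 : ℝ)⟩ : TangentBundle I N) = ⟨x, ξ⟩}

/-- `S` is a smooth submanifold of codimension `m`: near each of its points it is the zero set of
a smooth `Φ = (Φ¹, …, Φᵐ)` whose differentials are independent along `S`. -/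
def IsSubmanifoldOfCodim (m : ℕ) (S : Set N) : Prop :=
  ∀ x ∈ S, ∃ U : Set N, IsOpen U ∧ x ∈ U ∧ ∃ Φ : N → (Fin m → ℝ),
    ContMDiffOn I 𝓘(ℝ, Fin m → ℝ) ∞ Φ U ∧ (∀ y ∈ U, y ∈ S ↔ Φ y = 0) ∧
    ∀ y ∈ U, y ∈ S → Function.Surjective (mfderiv I 𝓘(ℝ, Fin m → ℝ) Φ y)

/-- The exterior derivative `(dθ)_x (u, v)` of a 1-form `θ` on a manifold without boundary,
computed in the preferred chart at `x`. -/
def extDerivOneForm (θ : ∀ y : N, TangentSpace I y →L[ℝ] ℝ) (x : N) (u v : TangentSpace I x) : ℝ :=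
  let φ := extChartAt I x
  let θφ : E → E →L[ℝ] ℝ := fun y => (θ (φ.symm y)).comp (mfderiv 𝓘(ℝ, E) I φ.symm y)
  extDeriv (fun y => ContinuousAlternatingMap.ofSubsingleton ℝ E ℝ (0 : Fin 1) (θφ y)) (φ x)
    ![mfderiv I 𝓘(ℝ, E) φ x u, mfderiv I 𝓘(ℝ, E) φ x v]

/-- The velocity `ċ(t) ∈ TN` of a curve defined on the interval `J` (one-sided at an end point
of `J` that belongs to `J`). -/
def velocity (c : ℝ → N) (J : Set ℝ) (t : ℝ) : TangentBundle I N :=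
  ⟨c t, mfderivWithin 𝓘(ℝ, ℝ) I c J t (1 : ℝ)⟩

end General

/-! ### The bundles `T*Q` and `T*Q ⊕ TQ`, and the vakonomic Hamiltonian system -/

section Bundles

variable (E Q : Type*) [NormedAddCommGroup E] [NormedSpace ℝ E]
  [TopologicalSpace Q] [ChartedSpace E Q] [IsManifold 𝓘(ℝ, E) 1 Q]

/-- The cotangent bundle `T*Q`. -/
abbrev Cotangent : Type _ :=
  TotalSpace (E →L[ℝ] ℝ) (fun q : Q => TangentSpace 𝓘(ℝ, E) q →L[ℝ] (Trivial Q ℝ) q)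

/-- The Whitney sum `T*Q ⊕ TQ`; a point is `⟨q, (p, v)⟩`. -/
abbrev WhitneySum : Type _ :=
  TotalSpace ((E →L[ℝ] ℝ) × E)
    ((fun q : Q => TangentSpace 𝓘(ℝ, E) q →L[ℝ] (Trivial Q ℝ) q) ×ᵇ
      (TangentSpace 𝓘(ℝ, E) : Q → Type _))

/-- The model with corners of `T*Q`. -/
abbrev cotangentModel := (𝓘(ℝ, E)).prod 𝓘(ℝ, E →L[ℝ] ℝ)

/-- The model with corners of `T*Q ⊕ TQ`. -/
abbrev whitneyModel := (𝓘(ℝ, E)).prod 𝓘(ℝ, (E →L[ℝ] ℝ) × E)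

variable {E Q}

/-- The covector part `p ∈ T*_q Q` of a point of `T*Q ⊕ TQ`. -/
def covec (w : WhitneySum E Q) : TangentSpace 𝓘(ℝ, E) w.proj →L[ℝ] ℝ := w.snd.1

/-- The projection `pr₁ : T*Q ⊕ TQ → T*Q`. -/
def pr₁ (w : WhitneySum E Q) : Cotangent E Q := ⟨w.proj, w.snd.1⟩

/-- The projection `pr₂ : T*Q ⊕ TQ → TQ`. -/
def pr₂ (w : WhitneySum E Q) : TangentBundle 𝓘(ℝ, E) Q := ⟨w.proj, w.snd.2⟩

/-- The Liouville 1-form `θ_Q` on `T*Q`: `θ_Q(p)(ξ) = p(Tπ_Q ξ)`. -/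
def liouville (α : Cotangent E Q) : TangentSpace (cotangentModel E) α →L[ℝ] ℝ :=
  ContinuousLinearMap.comp (show TangentSpace 𝓘(ℝ, E) α.proj →L[ℝ] ℝ from α.snd)
    (mfderiv (cotangentModel E) 𝓘(ℝ, E) (fun β : Cotangent E Q => β.proj) α)

/-- The canonical symplectic form `ω_Q = -dθ_Q` of `T*Q` (locally `dq^A ∧ dp_A`). -/
def canonicalForm (α : Cotangent E Q) (u v : TangentSpace (cotangentModel E) α) : ℝ :=
  -extDerivOneForm (cotangentModel E) liouville α u v

/-- `W₀ = T*Q ×_Q M = pr₂⁻¹(M)`. -/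
def W₀ (M : Set (TangentBundle 𝓘(ℝ, E) Q)) : Set (WhitneySum E Q) := pr₂ ⁻¹' M

/-- The form `ω = π₁* ω_Q`, evaluated on tangent vectors at `w`. -/
def form (w : WhitneySum E Q) (u v : TangentSpace (whitneyModel E) w) : ℝ :=
  canonicalForm (pr₁ w)
    (mfderiv (whitneyModel E) (cotangentModel E) (pr₁ : WhitneySum E Q → Cotangent E Q) w u)
    (mfderiv (whitneyModel E) (cotangentModel E) (pr₁ : WhitneySum E Q → Cotangent E Q) w v)

/-- The function `⟨pr₁, pr₂⟩ - pr₂* L` on `T*Q ⊕ TQ`. Its restriction to `W₀` is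
`H_{W₀} = ⟨π₁, π₂⟩ - π₂* L̃`, with `L̃ = L|_M`. -/
def hamiltonian (L : TangentBundle 𝓘(ℝ, E) Q → ℝ) (w : WhitneySum E Q) : ℝ :=
  covec w w.snd.2 - L (pr₂ w)

/-- The differential of the Hamiltonian at `w`. On vectors tangent to `W₀` it is `dH_{W₀}(w)`. -/
def dHamiltonian (L : TangentBundle 𝓘(ℝ, E) Q → ℝ) (w : WhitneySum E Q)
    (u : TangentSpace (whitneyModel E) w) : ℝ :=
  mfderiv (whitneyModel E) 𝓘(ℝ, ℝ) (hamiltonian L) w u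

/-- `X ∈ T_w W₀` solves `i_X ω = dH_{W₀}` at the point `w` of `W₀`. -/
def SolvesAt (L : TangentBundle 𝓘(ℝ, E) Q → ℝ) (M : Set (TangentBundle 𝓘(ℝ, E) Q))
    (w : WhitneySum E Q) (X : TangentSpace (whitneyModel E) w) : Prop :=
  X ∈ tangentVectors (whitneyModel E) (W₀ M) w ∧
    ∀ V ∈ tangentVectors (whitneyModel E) (W₀ M) w, form w X V = dHamiltonian L w V

/-- `W₁`: the points of `W₀` at which `i_X ω = dH_{W₀}` has a solution. -/
def W₁ (L : TangentBundle 𝓘(ℝ, E) Q → ℝ) (M : Set (TangentBundle 𝓘(ℝ, E) Q)) :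
    Set (WhitneySum E Q) :=
  {w | w ∈ W₀ M ∧ ∃ X : TangentSpace (whitneyModel E) w, SolvesAt L M w X}

/-- The kernel of `ω` (as a form on `W₀`) at `w`. -/
def kerForm (M : Set (TangentBundle 𝓘(ℝ, E) Q)) (w : WhitneySum E Q) :
    Set (TangentSpace (whitneyModel E) w) :=
  {V | V ∈ tangentVectors (whitneyModel E) (W₀ M) w ∧
    ∀ U ∈ tangentVectors (whitneyModel E) (W₀ M) w, form w V U = 0}

/-- The curve `w : J → W₀` is an integral curve of `i_X ω = dH_{W₀}`: it is differentiable, and at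
each time its velocity `X = ẇ(t)` solves the equation at `w(t)`. -/
def IsSolutionCurve (L : TangentBundle 𝓘(ℝ, E) Q → ℝ) (M : Set (TangentBundle 𝓘(ℝ, E) Q))
    (J : Set ℝ) (w : ℝ → WhitneySum E Q) : Prop :=
  ∀ t ∈ J, w t ∈ W₀ M ∧ MDifferentiableWithinAt 𝓘(ℝ, ℝ) (whitneyModel E) w J t ∧
    SolvesAt L M (w t) (mfderivWithin 𝓘(ℝ, ℝ) (whitneyModel E) w J t (1 : ℝ))

/-- The canonical vertical endomorphism `S = dq^A ⊗ ∂/∂q̇^A` of `T(TQ)` at `x`: project a vector to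
`T_q Q`, then lift it vertically to `x`. -/
def verticalEndo (x : TangentBundle 𝓘(ℝ, E) Q) :
    TangentSpace (𝓘(ℝ, E)).tangent x →L[ℝ] TangentSpace (𝓘(ℝ, E)).tangent x :=
  ContinuousLinearMap.comp
    (mfderiv 𝓘(ℝ, E) (𝓘(ℝ, E)).tangent
      (fun u : E => (⟨x.proj, u⟩ : TangentBundle 𝓘(ℝ, E) Q)) (show E from x.snd))
    (mfderiv (𝓘(ℝ, E)).tangent 𝓘(ℝ, E) (fun y : TangentBundle 𝓘(ℝ, E) Q => y.proj) x)

/-- The annihilator `(T_x M)°` in the dual of `T_x(TQ)`. -/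
def annihilator (M : Set (TangentBundle 𝓘(ℝ, E) Q)) (x : TangentBundle 𝓘(ℝ, E) Q) :
    Submodule ℝ (Module.Dual ℝ (TangentSpace (𝓘(ℝ, E)).tangent x)) :=
  (Submodule.span ℝ (tangentVectors (𝓘(ℝ, E)).tangent M x)).dualAnnihilator

/-- The admissibility condition: `dim (T_x M)° = dim S*((T_x M)°)` for all `x ∈ M`. -/
def IsAdmissible (M : Set (TangentBundle 𝓘(ℝ, E) Q)) : Prop :=
  ∀ x ∈ M, Module.finrank ℝ (annihilator M x) =
    Module.finrank ℝ
      ((annihilator M x).map ((verticalEndo x).toLinearMap.dualMap))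

end Bundles

/-! ### Local coordinates `(q^A, q̇^a)` on `M` -/

section Coordinates

/-- The coordinate space of dimension `n = m + k`. An index `α ∈ {1, …, m}` of a constrained
velocity is `Fin.castAdd k α`, an index `a ∈ {m + 1, …, n}` of a free one is `Fin.natAdd m a`. -/
abbrev Coord (m k : ℕ) : Type := EuclideanSpace ℝ (Fin (m + k))

variable {m k : ℕ} {Q : Type*} [TopologicalSpace Q] [ChartedSpace (Coord m k) Q]
  [IsManifold 𝓘(ℝ, Coord m k) ∞ Q]

/-- The components `v^A` of a tangent vector in the chart `e`. -/
def vel (e : OpenPartialHomeomorph Q (Coord m k)) (v : TangentBundle 𝓘(ℝ, Coord m k) Q) :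
    Coord m k :=
  mfderiv 𝓘(ℝ, Coord m k) 𝓘(ℝ, Coord m k) e v.proj v.snd

/-- The tangent vector with base point `x` and components `v^A` in the chart `e`. -/
def tangentOf (e : OpenPartialHomeomorph Q (Coord m k)) (x v : Coord m k) :
    TangentBundle 𝓘(ℝ, Coord m k) Q :=
  ⟨e.symm x, mfderiv 𝓘(ℝ, Coord m k) 𝓘(ℝ, Coord m k) e.symm x v⟩

/-- The momentum coordinate `p_A = p(∂/∂q^A)` of a point of `T*Q ⊕ TQ` in the chart `e`. -/
def mom (e : OpenPartialHomeomorph Q (Coord m k)) (w : WhitneySum (Coord m k) Q)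
    (A : Fin (m + k)) : ℝ :=
  covec w (tangentOf e (e w.proj) (EuclideanSpace.single A 1)).snd

/-- The last `k` components `v^a` of a vector. -/
def free (v : Coord m k) : Fin k → ℝ := fun a => v (Fin.natAdd m a)

/-- The vector with components `v^α = s^α` and `v^a = y^a`. -/
def glue (s : Fin m → ℝ) (y : Fin k → ℝ) : Coord m k := WithLp.toLp 2 (Fin.append s y)

/-- Local coordinates `(q^A, q̇^a)` for `M ⊆ TQ`: coordinates `q^A` on `Q` and an open set
`U ⊆ TQ` over their domain, such that `M ∩ U` is the graph `q̇^α = Ψ^α(q^A, q̇^a)` of a smooth map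
`Ψ` on the open set `O` of the values of `(q^A, q̇^a)`. -/
structure ConstraintChart (M : Set (TangentBundle 𝓘(ℝ, Coord m k) Q)) where
  e : OpenPartialHomeomorph Q (Coord m k)
  e_mem : e ∈ IsManifold.maximalAtlas 𝓘(ℝ, Coord m k) ∞ Q
  U : Set (TangentBundle 𝓘(ℝ, Coord m k) Q)
  isOpen_U : IsOpen U
  U_subset : ∀ v ∈ U, v.proj ∈ e.source
  O : Set (Coord m k × (Fin k → ℝ))
  isOpen_O : IsOpen O
  Ψ : Coord m k × (Fin k → ℝ) → (Fin m → ℝ)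
  smooth_Ψ : ContDiffOn ℝ ∞ Ψ O
  mem_iff : ∀ v ∈ U, v ∈ M ↔ (e v.proj, free (vel e v)) ∈ O ∧
    ∀ α, vel e v (Fin.castAdd k α) = Ψ (e v.proj, free (vel e v)) α
  graph_mem : ∀ z ∈ O, z.1 ∈ e.target ∧ tangentOf e z.1 (glue (Ψ z) z.2) ∈ U

/-- The partial derivative `∂f/∂q^A` of a function of `(q^A, q̇^a)`. -/
def dq (f : Coord m k × (Fin k → ℝ) → ℝ) (A : Fin (m + k)) (z : Coord m k × (Fin k → ℝ)) : ℝ :=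
  fderiv ℝ f z (EuclideanSpace.single A 1, 0)

/-- The partial derivative `∂f/∂q̇^a` of a function of `(q^A, q̇^a)`. -/
def dqdot (f : Coord m k × (Fin k → ℝ) → ℝ) (a : Fin k) (z : Coord m k × (Fin k → ℝ)) : ℝ :=
  fderiv ℝ f z (0, Pi.single a 1)

namespace ConstraintChart

variable {M : Set (TangentBundle 𝓘(ℝ, Coord m k) Q)} (C : ConstraintChart M)

/-- The restricted Lagrangian `L̃ = L|_M` as a function of `(q^A, q̇^a)`. -/
def restrictedL (L : TangentBundle 𝓘(ℝ, Coord m k) Q → ℝ) (z : Coord m k × (Fin k → ℝ)) : ℝ :=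
  L (tangentOf C.e z.1 (glue (C.Ψ z) z.2))

/-- The coordinates `(q^A, q̇^a)` of the velocity part of a point of `T*Q ⊕ TQ`. -/
def coords (w : WhitneySum (Coord m k) Q) : Coord m k × (Fin k → ℝ) :=
  (C.e w.proj, free (vel C.e (pr₂ w)))

/-- The equations `p_a = ∂L̃/∂q̇^a - p_α ∂Ψ^α/∂q̇^a`, for all `a`. -/
def MomentumEquations (L : TangentBundle 𝓘(ℝ, Coord m k) Q → ℝ)
    (w : WhitneySum (Coord m k) Q) : Prop :=
  ∀ a : Fin k, mom C.e w (Fin.natAdd m a) =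
    dqdot (C.restrictedL L) a (C.coords w) -
      ∑ α : Fin m, mom C.e w (Fin.castAdd k α) * dqdot (fun z => C.Ψ z α) a (C.coords w)

/-- The vakonomic equations on the interval `J`, for a twice differentiable coordinate curve
`x = (q^A(t))` and differentiable multipliers `μ_α(t)`:
`d/dt (∂L̃/∂q̇^a) - ∂L̃/∂q^a = μ_α [d/dt (∂Ψ^α/∂q̇^a) - ∂Ψ^α/∂q^a] + μ̇_α ∂Ψ^α/∂q̇^a`,
`μ̇_α = ∂L̃/∂q^α - μ_β ∂Ψ^β/∂q^α`, and `q̇^α = Ψ^α(q^A, q̇^a)`. -/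
def VakonomicEquations (L : TangentBundle 𝓘(ℝ, Coord m k) Q → ℝ) (J : Set ℝ)
    (x : ℝ → Coord m k) (μ : ℝ → Fin m → ℝ) : Prop :=
  let ℓ := C.restrictedL L
  let v : ℝ → Coord m k := derivWithin x J
  let z : ℝ → Coord m k × (Fin k → ℝ) := fun t => (x t, free (v t))
  ∀ t ∈ J,
    DifferentiableWithinAt ℝ x J t ∧ DifferentiableWithinAt ℝ v J t ∧
    DifferentiableWithinAt ℝ μ J t ∧ z t ∈ C.O ∧
    (∀ a : Fin k,
      derivWithin (fun s => dqdot ℓ a (z s)) J t - dq ℓ (Fin.natAdd m a) (z t) =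
        ∑ α : Fin m,
          (μ t α * (derivWithin (fun s => dqdot (fun y => C.Ψ y α) a (z s)) J t -
              dq (fun y => C.Ψ y α) (Fin.natAdd m a) (z t)) +
            derivWithin (fun s => μ s α) J t * dqdot (fun y => C.Ψ y α) a (z t))) ∧
    (∀ α : Fin m,
      derivWithin (fun s => μ s α) J t =
        dq ℓ (Fin.castAdd k α) (z t) -
          ∑ β : Fin m, μ t β * dq (fun y => C.Ψ y β) (Fin.castAdd k α) (z t)) ∧
    (∀ α : Fin m, v t (Fin.castAdd k α) = C.Ψ (z t) α)

end ConstraintChart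

end Coordinates

end Vakonomic

end

open Vakonomic

/-! In the coordinates (q, p, v) that a chart of Q induces on T*Q ⊕ TQ, the Liouville form is p dq,
hence ω(X, V) = δp_V(δq_X) - δp_X(δq_V) (`liouville_eq`, `canonicalForm_eq`, `form_eq`). Where M is
the graph q̇^α = Ψ^α(q, q̇^a), a tangent vector of W₀ is given by arbitrary δq, δp, δq̇^a, and the
remaining components are DΨ(δq, δq̇^a) (`mem_tangentVectors_iff`, `exists_tangentVector`). On such
vectors dH involves only L̃ and Ψ (`dHamiltonian_tangent`).

The three kinds of variation can therefore be tested separately in i_X ω = dH (`solvesAt_iff`).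
Varying p says that the q-component of X is v. Varying q gives ṗ_A = ∂L̃/∂q^A - p_α ∂Ψ^α/∂q^A.
Varying q̇^a, the directions of ker ω, puts no condition on X and gives exactly the momentum
equations at w. These equations are thus both the condition dH = 0 on ker ω and the only obstruction
to solving for X.

Along a curve, the first condition says that v is the velocity of the base curve. Differentiating
the momentum equations in time and comparing with the formula for ṗ_a yields the first vakonomic
equation; the formula for ṗ_α is the second, and membership in W₀ is the third
(`vakonomicEquations_iff`). Conversely, a vakonomic solution determines p_α = μ_α, then p_a by the
momentum equations, and this lift is differentiable because c is twice differentiable.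

For the existence of the coordinates, let l be a functional that vanishes on the range of ∂Φ/∂q̇.
Then l ∘ dΦ annihilates T_xM and S* kills it. Admissibility makes S* injective on the annihilator,
so l ∘ dΦ = 0 and l = 0: ∂Φ/∂q̇ is surjective (`surjective_fderiv_of_admissible`). A linear change
of chart turns it into the projection to the first m components, and the implicit function theorem
solves for q̇^α (`exists_constraintChart_of_fderiv`). -/

noncomputable section

namespace Vakonomic

/-! ### Induced coordinates on TQ, T*Q and T*Q ⊕ TQ -/

section ChartCoordinates

variable {E Q : Type*} [NormedAddCommGroup E] [NormedSpace ℝ E]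
  [TopologicalSpace Q] [ChartedSpace E Q]

/-- The derivative of a chart is inverted by the derivative of its inverse. -/
theorem mfderiv_chart_symm_apply [IsManifold 𝓘(ℝ, E) ∞ Q] {e : OpenPartialHomeomorph Q E}
    (he : e ∈ IsManifold.maximalAtlas 𝓘(ℝ, E) ∞ Q) {x : E} (hx : x ∈ e.target) :
    (mfderiv 𝓘(ℝ, E) 𝓘(ℝ, E) e (e.symm x)).comp (mfderiv 𝓘(ℝ, E) 𝓘(ℝ, E) e.symm x) =
      ContinuousLinearMap.id ℝ (TangentSpace 𝓘(ℝ, E) x) := by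
  have h : e.MDifferentiable 𝓘(ℝ, E) 𝓘(ℝ, E) :=
    ⟨(contMDiffOn_of_mem_maximalAtlas he).mdifferentiableOn (by simp),
      (contMDiffOn_symm_of_mem_maximalAtlas he).mdifferentiableOn (by simp)⟩
  exact h.comp_symm_deriv hx

theorem mfderiv_symm_chart_apply [IsManifold 𝓘(ℝ, E) ∞ Q] {e : OpenPartialHomeomorph Q E}
    (he : e ∈ IsManifold.maximalAtlas 𝓘(ℝ, E) ∞ Q) {q : Q} (hq : q ∈ e.source) :
    (mfderiv 𝓘(ℝ, E) 𝓘(ℝ, E) e.symm (e q)).comp (mfderiv 𝓘(ℝ, E) 𝓘(ℝ, E) e q) =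
      ContinuousLinearMap.id ℝ (TangentSpace 𝓘(ℝ, E) q) := by
  have h : e.MDifferentiable 𝓘(ℝ, E) 𝓘(ℝ, E) :=
    ⟨(contMDiffOn_of_mem_maximalAtlas he).mdifferentiableOn (by simp),
      (contMDiffOn_symm_of_mem_maximalAtlas he).mdifferentiableOn (by simp)⟩
  exact h.symm_comp_deriv hq

variable [IsManifold 𝓘(ℝ, E) ∞ Q]

/-- The coordinates `(q, p)` on `T*Q` induced by a chart `e` of `Q`. -/
def cotangentCoords (e : OpenPartialHomeomorph Q E) (α : Cotangent E Q) : E × (E →L[ℝ] ℝ) :=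
  (e α.proj, ContinuousLinearMap.comp (show TangentSpace 𝓘(ℝ, E) α.proj →L[ℝ] ℝ from α.snd)
    (show E →L[ℝ] E from mfderiv 𝓘(ℝ, E) 𝓘(ℝ, E) e.symm (e α.proj)))

/-- The coordinates `(q, v)` on `TQ` induced by a chart `e` of `Q`. -/
def tangentCoords (e : OpenPartialHomeomorph Q E) (v : TangentBundle 𝓘(ℝ, E) Q) : E × E :=
  (e v.proj, mfderiv 𝓘(ℝ, E) 𝓘(ℝ, E) e v.proj v.snd)

/-- The point of `TQ` with given coordinates `(q, v)` in the chart `e`. -/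
def ofTangentCoords (e : OpenPartialHomeomorph Q E) (y : E × E) : TangentBundle 𝓘(ℝ, E) Q :=
  ⟨e.symm y.1, mfderiv 𝓘(ℝ, E) 𝓘(ℝ, E) e.symm y.1 y.2⟩

/-- The point of `T*Q` with given coordinates `(q, p)` in the chart `e`. -/
def ofCotangentCoords (e : OpenPartialHomeomorph Q E) (y : E × (E →L[ℝ] ℝ)) : Cotangent E Q :=
  ⟨e.symm y.1, ContinuousLinearMap.comp y.2
    (show E →L[ℝ] E from mfderiv 𝓘(ℝ, E) 𝓘(ℝ, E) e (e.symm y.1))⟩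

theorem contMDiffAt_pr₁ (w : WhitneySum E Q) :
    ContMDiffAt (whitneyModel E) (cotangentModel E) ∞ (pr₁ : WhitneySum E Q → Cotangent E Q) w := by
  have h := (contMDiffAt_totalSpace (n := ∞) (f := (id : WhitneySum E Q → WhitneySum E Q))
    (IB := 𝓘(ℝ, E)) (IM := whitneyModel E) (x₀ := w)).1 contMDiffAt_id
  refine contMDiffAt_totalSpace.2 ⟨h.1, ?_⟩
  exact contDiff_fst.contMDiff.contMDiffAt.comp w h.2

theorem contMDiffAt_pr₂ (w : WhitneySum E Q) :
    ContMDiffAt (whitneyModel E) (𝓘(ℝ, E)).tangent ∞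
      (pr₂ : WhitneySum E Q → TangentBundle 𝓘(ℝ, E) Q) w := by
  have h := (contMDiffAt_totalSpace (n := ∞) (f := (id : WhitneySum E Q → WhitneySum E Q))
    (IB := 𝓘(ℝ, E)) (IM := whitneyModel E) (x₀ := w)).1 contMDiffAt_id
  refine contMDiffAt_totalSpace.2 ⟨h.1, ?_⟩
  exact (contDiff_snd (E := E →L[ℝ] ℝ) (F := E) (𝕜 := ℝ)).contMDiff.contMDiffAt.comp w h.2


/-- The derivative of a chart, read in the trivialization of `TQ` at a point. -/
theorem contMDiffAt_mfderiv_comp_symmL {e : OpenPartialHomeomorph Q E}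
    (he : e ∈ IsManifold.maximalAtlas 𝓘(ℝ, E) ∞ Q) {q₀ : Q} (hq : q₀ ∈ e.source) :
    ContMDiffAt 𝓘(ℝ, E) 𝓘(ℝ, E →L[ℝ] E) ∞ (fun q => ContinuousLinearMap.comp
      (mfderiv 𝓘(ℝ, E) 𝓘(ℝ, E) e q)
      ((trivializationAt E (TangentSpace 𝓘(ℝ, E)) q₀).symmL ℝ q) : Q → E →L[ℝ] E) q₀ := by
  have h := (contMDiffAt_of_mem_maximalAtlas he hq).mfderiv_const (m := ∞) (by simp)
  refine h.congr_of_eventuallyEq (Eventually.of_forall fun q => ?_)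
  ext u
  simp [inTangentCoordinates, ContinuousLinearMap.inCoordinates]
  rfl

/-- The derivative of the inverse of a chart, read in the trivialization of `TQ` at a point. -/
theorem contMDiffAt_continuousLinearMapAt_comp_mfderiv_symm {e : OpenPartialHomeomorph Q E}
    (he : e ∈ IsManifold.maximalAtlas 𝓘(ℝ, E) ∞ Q) {x₀ : E} (hx : x₀ ∈ e.target) :
    ContMDiffAt 𝓘(ℝ, E) 𝓘(ℝ, E →L[ℝ] E) ∞ (fun x => ContinuousLinearMap.comp
      ((trivializationAt E (TangentSpace 𝓘(ℝ, E)) (e.symm x₀)).continuousLinearMapAt ℝ (e.symm x))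
      (mfderiv 𝓘(ℝ, E) 𝓘(ℝ, E) e.symm x) : E → E →L[ℝ] E) x₀ := by
  have h := (contMDiffAt_symm_of_mem_maximalAtlas he hx).mfderiv_const (m := ∞) (by simp)
  refine h.congr_of_eventuallyEq (Eventually.of_forall fun q => ?_)
  ext u
  simp [inTangentCoordinates, ContinuousLinearMap.inCoordinates]
  rfl

/-- Read in the trivialization at the base point of `v`, the derivative of the chart is a smooth
family of linear maps, applied to the smooth fibre component. -/
theorem contMDiffAt_tangentCoords {e : OpenPartialHomeomorph Q E}
    (he : e ∈ IsManifold.maximalAtlas 𝓘(ℝ, E) ∞ Q) {v : TangentBundle 𝓘(ℝ, E) Q}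
    (hv : v.proj ∈ e.source) :
    ContMDiffAt (𝓘(ℝ, E)).tangent 𝓘(ℝ, E × E) ∞ (tangentCoords e) v := by
  have h := (contMDiffAt_totalSpace (n := ∞)
    (f := (id : TangentBundle 𝓘(ℝ, E) Q → TangentBundle 𝓘(ℝ, E) Q))
    (IB := 𝓘(ℝ, E)) (IM := (𝓘(ℝ, E)).tangent) (x₀ := v)).1 contMDiffAt_id
  have hB := (contMDiffAt_mfderiv_comp_symmL he hv).comp v h.1
  refine ((contMDiffAt_of_mem_maximalAtlas he hv).comp v h.1).prodMk_space ?_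
  refine (hB.clm_apply h.2).congr_of_eventuallyEq ?_
  have hb : ∀ᶠ y : TangentBundle 𝓘(ℝ, E) Q in 𝓝 v,
      y.proj ∈ (trivializationAt E (TangentSpace 𝓘(ℝ, E)) v.proj).baseSet :=
    h.1.continuousAt.eventually_mem
      ((trivializationAt E (TangentSpace 𝓘(ℝ, E)) v.proj).open_baseSet.mem_nhds
        (mem_baseSet_trivializationAt _ _ _))
  filter_upwards [hb] with y hy
  have := (trivializationAt E (TangentSpace 𝓘(ℝ, E)) v.proj).symmL_continuousLinearMapAt
    (R := ℝ) hy y.snd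
  rw [Trivialization.continuousLinearMapAt_apply_of_mem (R := ℝ) _ hy] at this
  exact congrArg _ this.symm

theorem contMDiffAt_ofTangentCoords {e : OpenPartialHomeomorph Q E}
    (he : e ∈ IsManifold.maximalAtlas 𝓘(ℝ, E) ∞ Q) {y : E × E} (hy : y.1 ∈ e.target) :
    ContMDiffAt 𝓘(ℝ, E × E) (𝓘(ℝ, E)).tangent ∞ (ofTangentCoords e) y := by
  have h1 : ContMDiffAt 𝓘(ℝ, E × E) 𝓘(ℝ, E) ∞ (fun z : E × E => e.symm z.1) y :=
    (contMDiffAt_symm_of_mem_maximalAtlas he hy).comp y contDiff_fst.contMDiff.contMDiffAt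
  refine contMDiffAt_totalSpace.2 ⟨h1, ?_⟩
  have hA := (contMDiffAt_continuousLinearMapAt_comp_mfderiv_symm he hy).comp y
    (contDiff_fst (E := E) (F := E) (𝕜 := ℝ)).contMDiff.contMDiffAt
  refine (hA.clm_apply
    (contDiff_snd (E := E) (F := E) (𝕜 := ℝ)).contMDiff.contMDiffAt).congr_of_eventuallyEq ?_
  have hb : ∀ᶠ z : E × E in 𝓝 y,
      e.symm z.1 ∈ (trivializationAt E (TangentSpace 𝓘(ℝ, E)) (e.symm y.1)).baseSet :=
    h1.continuousAt.eventually_mem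
      ((trivializationAt E (TangentSpace 𝓘(ℝ, E)) (e.symm y.1)).open_baseSet.mem_nhds
        (mem_baseSet_trivializationAt _ _ _))
  filter_upwards [hb] with z hz
  have := Trivialization.continuousLinearMapAt_apply_of_mem (R := ℝ) _ hz
    (mfderiv 𝓘(ℝ, E) 𝓘(ℝ, E) e.symm z.1 z.2)
  exact this.symm

theorem contMDiffAt_cotangentCoords {e : OpenPartialHomeomorph Q E}
    (he : e ∈ IsManifold.maximalAtlas 𝓘(ℝ, E) ∞ Q) {α : Cotangent E Q}
    (hα : α.proj ∈ e.source) :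
    ContMDiffAt (cotangentModel E) 𝓘(ℝ, E × (E →L[ℝ] ℝ)) ∞ (cotangentCoords e) α := by
  have h := (contMDiffAt_hom_bundle (n := ∞) (f := (id : Cotangent E Q → Cotangent E Q))
    (IB := 𝓘(ℝ, E)) (IM := cotangentModel E) (x₀ := α)).1 contMDiffAt_id
  have h1 := (contMDiffAt_of_mem_maximalAtlas he hα).comp α h.1
  have hA := (contMDiffAt_continuousLinearMapAt_comp_mfderiv_symm he (e.map_source hα)).comp α h1
  refine h1.prodMk_space ((h.2.clm_comp hA).congr_of_eventuallyEq ?_)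
  have hb : ∀ᶠ y : Cotangent E Q in 𝓝 α,
      y.proj ∈ (trivializationAt E (TangentSpace 𝓘(ℝ, E)) α.proj).baseSet ∩ e.source :=
    h.1.continuousAt.eventually_mem (inter_mem
      ((trivializationAt E (TangentSpace 𝓘(ℝ, E)) α.proj).open_baseSet.mem_nhds
        (mem_baseSet_trivializationAt _ _ _)) (e.open_source.mem_nhds hα))
  filter_upwards [hb] with y hy
  ext u
  -- The base point that appears is `e.symm (e y.proj)`, equal to `y.proj` only propositionally. A
  -- variable `q'` allows the substitution inside dependent types.
  have key : ∀ q' : Q, q' = y.proj → ∀ u : E,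
      (trivializationAt E (TangentSpace 𝓘(ℝ, E)) α.proj).symmL ℝ y.proj
        ((trivializationAt E (TangentSpace 𝓘(ℝ, E)) α.proj).continuousLinearMapAt ℝ q' u) = u := by
    rintro _ rfl u
    exact (trivializationAt E (TangentSpace 𝓘(ℝ, E)) α.proj).symmL_continuousLinearMapAt
      (R := ℝ) hy.1 u
  have hq' : e.symm (e α.proj) = α.proj := e.left_inv hα
  simp only [ContinuousLinearMap.inCoordinates, Function.comp_def, hq', id,
    Bundle.Trivial.continuousLinearMapAt_trivialization, Bundle.Trivial.fiberBundle_trivializationAt']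
  exact congrArg (show E →L[ℝ] ℝ from y.snd) (key _ (e.left_inv hy.2)
    (show E from mfderiv 𝓘(ℝ, E) 𝓘(ℝ, E) e.symm (e y.proj) u)).symm

theorem contMDiffAt_ofCotangentCoords {e : OpenPartialHomeomorph Q E}
    (he : e ∈ IsManifold.maximalAtlas 𝓘(ℝ, E) ∞ Q) {y : E × (E →L[ℝ] ℝ)} (hy : y.1 ∈ e.target) :
    ContMDiffAt 𝓘(ℝ, E × (E →L[ℝ] ℝ)) (cotangentModel E) ∞ (ofCotangentCoords e) y := by
  have h1 : ContMDiffAt 𝓘(ℝ, E × (E →L[ℝ] ℝ)) 𝓘(ℝ, E) ∞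
      (fun z : E × (E →L[ℝ] ℝ) => e.symm z.1) y :=
    (contMDiffAt_symm_of_mem_maximalAtlas he hy).comp y contDiff_fst.contMDiff.contMDiffAt
  refine (contMDiffAt_hom_bundle _).2 ⟨h1, ?_⟩
  have hB := (contMDiffAt_mfderiv_comp_symmL he (e.map_target hy)).comp y h1
  refine (ContMDiffAt.clm_comp
    (contDiff_snd (E := E) (F := E →L[ℝ] ℝ) (𝕜 := ℝ)).contMDiff.contMDiffAt
    hB).congr_of_eventuallyEq (Eventually.of_forall fun z => ?_)
  ext u
  simp [ContinuousLinearMap.inCoordinates, ofCotangentCoords]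
  try rfl

/-- The coordinates `(q, p, v)` on `T*Q ⊕ TQ` induced by a chart `e` of `Q`. -/
def whitneyCoords (e : OpenPartialHomeomorph Q E) (w : WhitneySum E Q) : E × (E →L[ℝ] ℝ) × E :=
  (e w.proj, (cotangentCoords e (pr₁ w)).2, (tangentCoords e (pr₂ w)).2)

/-- The point of `T*Q ⊕ TQ` with given coordinates `(q, p, v)` in the chart `e`. -/
def ofWhitneyCoords (e : OpenPartialHomeomorph Q E) (y : E × (E →L[ℝ] ℝ) × E) : WhitneySum E Q :=
  ⟨e.symm y.1, ((ofCotangentCoords e (y.1, y.2.1)).snd, (ofTangentCoords e (y.1, y.2.2)).snd)⟩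

theorem contMDiffAt_whitneyCoords {e : OpenPartialHomeomorph Q E}
    (he : e ∈ IsManifold.maximalAtlas 𝓘(ℝ, E) ∞ Q) {w : WhitneySum E Q}
    (hw : w.proj ∈ e.source) :
    ContMDiffAt (whitneyModel E) 𝓘(ℝ, E × (E →L[ℝ] ℝ) × E) ∞ (whitneyCoords e) w := by
  have h1 : ContMDiffAt (whitneyModel E) 𝓘(ℝ, E × (E →L[ℝ] ℝ)) ∞
      (fun w => cotangentCoords e (pr₁ w)) w :=
    (contMDiffAt_cotangentCoords he (α := pr₁ w) hw).comp w (contMDiffAt_pr₁ w)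
  have h2 : ContMDiffAt (whitneyModel E) 𝓘(ℝ, E × E) ∞
      (fun w => tangentCoords e (pr₂ w)) w :=
    (contMDiffAt_tangentCoords he (v := pr₂ w) hw).comp w (contMDiffAt_pr₂ w)
  exact (contDiff_fst.contMDiff.contMDiffAt.comp w h1).prodMk_space
    ((contDiff_snd.contMDiff.contMDiffAt.comp w h1).prodMk_space
    (contDiff_snd.contMDiff.contMDiffAt.comp w h2))

theorem contMDiffAt_ofWhitneyCoords {e : OpenPartialHomeomorph Q E}
    (he : e ∈ IsManifold.maximalAtlas 𝓘(ℝ, E) ∞ Q) {y : E × (E →L[ℝ] ℝ) × E}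
    (hy : y.1 ∈ e.target) :
    ContMDiffAt 𝓘(ℝ, E × (E →L[ℝ] ℝ) × E) (whitneyModel E) ∞ (ofWhitneyCoords e) y := by
  have h1 : ContMDiffAt 𝓘(ℝ, E × (E →L[ℝ] ℝ) × E) (cotangentModel E) ∞
      (fun y : E × (E →L[ℝ] ℝ) × E => ofCotangentCoords e (y.1, y.2.1)) y :=
    (contMDiffAt_ofCotangentCoords he (y := (y.1, y.2.1)) hy).comp (f := fun y : E × (E →L[ℝ] ℝ) × E =>
      ((y.1, y.2.1) : E × (E →L[ℝ] ℝ))) y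
      (ContDiff.contMDiff (by fun_prop)).contMDiffAt
  have h2 : ContMDiffAt 𝓘(ℝ, E × (E →L[ℝ] ℝ) × E) (𝓘(ℝ, E)).tangent ∞
      (fun y : E × (E →L[ℝ] ℝ) × E => ofTangentCoords e (y.1, y.2.2)) y :=
    (contMDiffAt_ofTangentCoords he (y := (y.1, y.2.2)) hy).comp (f := fun y : E × (E →L[ℝ] ℝ) × E =>
      ((y.1, y.2.2) : E × E)) y
      (ContDiff.contMDiff (by fun_prop)).contMDiffAt
  rw [contMDiffAt_totalSpace] at h1 h2
  refine contMDiffAt_totalSpace.2 ⟨h1.1, ?_⟩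
  exact h1.2.prodMk_space h2.2

theorem tangentCoords_ofTangentCoords {e : OpenPartialHomeomorph Q E}
    (he : e ∈ IsManifold.maximalAtlas 𝓘(ℝ, E) ∞ Q) {y : E × E} (hy : y.1 ∈ e.target) :
    tangentCoords e (ofTangentCoords e y) = y := by
  refine Prod.ext (e.right_inv hy) ?_
  exact DFunLike.congr_fun (mfderiv_chart_symm_apply he hy) y.2

theorem ofTangentCoords_tangentCoords {e : OpenPartialHomeomorph Q E}
    (he : e ∈ IsManifold.maximalAtlas 𝓘(ℝ, E) ∞ Q) {v : TangentBundle 𝓘(ℝ, E) Q}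
    (hv : v.proj ∈ e.source) :
    ofTangentCoords e (tangentCoords e v) = v := by
  obtain ⟨q, v⟩ := v
  refine TotalSpace.ext (e.left_inv hv) ?_
  have := DFunLike.congr_fun (mfderiv_symm_chart_apply he hv) v
  exact heq_of_eq this

theorem whitneyCoords_ofWhitneyCoords {e : OpenPartialHomeomorph Q E}
    (he : e ∈ IsManifold.maximalAtlas 𝓘(ℝ, E) ∞ Q) {y : E × (E →L[ℝ] ℝ) × E}
    (hy : y.1 ∈ e.target) :
    whitneyCoords e (ofWhitneyCoords e y) = y := by
  refine Prod.ext (e.right_inv hy) (Prod.ext ?_ ?_)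
  · ext u
    have h := DFunLike.congr_fun (mfderiv_chart_symm_apply he hy) u
    have h2 : e (e.symm y.1) = y.1 := e.right_inv hy
    change y.2.1 (mfderiv 𝓘(ℝ, E) 𝓘(ℝ, E) e (e.symm y.1)
      (mfderiv 𝓘(ℝ, E) 𝓘(ℝ, E) e.symm (e (e.symm y.1)) u)) = y.2.1 u
    rw [h2]
    exact congrArg _ h
  · exact congrArg (Prod.snd : E × E → E)
      (tangentCoords_ofTangentCoords he (y := (y.1, y.2.2)) hy)

theorem ofWhitneyCoords_whitneyCoords {e : OpenPartialHomeomorph Q E}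
    (he : e ∈ IsManifold.maximalAtlas 𝓘(ℝ, E) ∞ Q) {w : WhitneySum E Q}
    (hw : w.proj ∈ e.source) :
    ofWhitneyCoords e (whitneyCoords e w) = w := by
  obtain ⟨q, p, v⟩ := w
  have hq : e.symm (e q) = q := e.left_inv hw
  refine TotalSpace.ext hq (heq_of_eq (Prod.ext ?_ ?_))
  · ext u
    have h := DFunLike.congr_fun (mfderiv_symm_chart_apply he hw) u
    change (show E →L[ℝ] ℝ from p) (mfderiv 𝓘(ℝ, E) 𝓘(ℝ, E) e.symm (e q)
      (mfderiv 𝓘(ℝ, E) 𝓘(ℝ, E) e (e.symm (e q)) u)) = (show E →L[ℝ] ℝ from p) u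
    rw [hq]
    exact congrArg _ h
  · exact DFunLike.congr_fun (mfderiv_symm_chart_apply he hw) v

end ChartCoordinates

/-! ### The Liouville and symplectic forms in coordinates -/

section Forms

variable {E Q : Type*} [NormedAddCommGroup E] [NormedSpace ℝ E]
  [TopologicalSpace Q] [ChartedSpace E Q]

theorem differentiableAt_ofSubsingleton {F G : Type*} [NormedAddCommGroup F] [NormedSpace ℝ F]
    [NormedAddCommGroup G] [NormedSpace ℝ G] {g : G → F →L[ℝ] ℝ} {z : G}
    (h : DifferentiableAt ℝ g z) : DifferentiableAt ℝ
      (fun y => ContinuousAlternatingMap.ofSubsingleton ℝ F ℝ (0 : Fin 1) (g y)) z :=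
  (ContinuousAlternatingMap.ofSubsingletonLIE (𝕜 := ℝ) (E := F) (F := ℝ)
    (0 : Fin 1)).differentiableAt.comp z h

/-- The exterior derivative of the 1-form `p dq` on `E × E*`. -/
theorem extDeriv_tautological (z : E × (E →L[ℝ] ℝ)) (a b : E × (E →L[ℝ] ℝ)) :
    extDeriv (fun y : E × (E →L[ℝ] ℝ) => ContinuousAlternatingMap.ofSubsingleton ℝ
      (E × (E →L[ℝ] ℝ)) ℝ (0 : Fin 1) (y.2.comp (ContinuousLinearMap.fst ℝ E (E →L[ℝ] ℝ)))) z
      ![a, b] = a.2 b.1 - b.2 a.1 := by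
  rw [extDeriv_apply]
  · have h : ∀ c d : E × (E →L[ℝ] ℝ),
        fderiv ℝ (fun y : E × (E →L[ℝ] ℝ) => y.2 c.1) z d = d.2 c.1 := by
      intro c d
      have : HasFDerivAt (fun y : E × (E →L[ℝ] ℝ) => y.2 c.1)
          ((ContinuousLinearMap.apply ℝ ℝ c.1).comp
            (ContinuousLinearMap.snd ℝ E (E →L[ℝ] ℝ))) z :=
        ((ContinuousLinearMap.apply ℝ ℝ c.1).comp
            (ContinuousLinearMap.snd ℝ E (E →L[ℝ] ℝ))).hasFDerivAt
      rw [this.fderiv]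
      rfl
    simp [Fin.sum_univ_two, Fin.removeNth, h]
    ring
  · have : DifferentiableAt ℝ (fun y : E × (E →L[ℝ] ℝ) =>
        y.2.comp (ContinuousLinearMap.fst ℝ E (E →L[ℝ] ℝ))) z := by fun_prop
    exact differentiableAt_ofSubsingleton this

variable [IsManifold 𝓘(ℝ, E) ∞ Q]

/-- The Liouville form is `p dq` in the coordinates induced by a chart. -/
theorem liouville_eq {e : OpenPartialHomeomorph Q E}
    (he : e ∈ IsManifold.maximalAtlas 𝓘(ℝ, E) ∞ Q) {α : Cotangent E Q} (hα : α.proj ∈ e.source)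
    (u : TangentSpace (cotangentModel E) α) :
    liouville α u = (cotangentCoords e α).2
      (mfderiv (cotangentModel E) 𝓘(ℝ, E × (E →L[ℝ] ℝ)) (cotangentCoords e) α u).1 := by
  have h1 : mfderiv (cotangentModel E) 𝓘(ℝ, E) (fun β : Cotangent E Q => e β.proj) α u =
      mfderiv 𝓘(ℝ, E) 𝓘(ℝ, E) e α.proj
        (mfderiv (cotangentModel E) 𝓘(ℝ, E) (fun β : Cotangent E Q => β.proj) α u) :=
    DFunLike.congr_fun (mfderiv_comp (I := cotangentModel E) (I' := 𝓘(ℝ, E)) α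
      ((contMDiffAt_of_mem_maximalAtlas he hα).mdifferentiableAt (by simp))
      ((contMDiffAt_proj (n := 1) _).mdifferentiableAt (by simp))) u
  have h2 : mfderiv (cotangentModel E) 𝓘(ℝ, E) (fun β : Cotangent E Q => e β.proj) α u =
      (mfderiv (cotangentModel E) 𝓘(ℝ, E × (E →L[ℝ] ℝ)) (cotangentCoords e) α u).1 := by
    have hd := (contMDiffAt_cotangentCoords he hα).mdifferentiableAt (by simp)
    have h := mfderiv_comp α
      (differentiableAt_fst (𝕜 := ℝ) (E := E) (F := E →L[ℝ] ℝ)).mdifferentiableAt hd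
    rw [mfderiv_eq_fderiv, fderiv_fst] at h
    exact DFunLike.congr_fun h u
  rw [← h2, h1]
  exact congrArg (show E →L[ℝ] ℝ from α.snd) (DFunLike.congr_fun (mfderiv_symm_chart_apply he hα)
    (mfderiv (cotangentModel E) 𝓘(ℝ, E) (fun β : Cotangent E Q => β.proj) α u)).symm

/-- The exterior derivative is defined in the preferred chart `φ` of T*Q, whereas the formula uses
the coordinates induced by `e`. The transition map `f` between the two pulls p dq back to the
Liouville form, and d commutes with pullback. -/
theorem canonicalForm_eq {e : OpenPartialHomeomorph Q E}
    (he : e ∈ IsManifold.maximalAtlas 𝓘(ℝ, E) ∞ Q) {α : Cotangent E Q} (hα : α.proj ∈ e.source)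
    (u v : TangentSpace (cotangentModel E) α) :
    canonicalForm α u v =
      (mfderiv (cotangentModel E) 𝓘(ℝ, E × (E →L[ℝ] ℝ)) (cotangentCoords e) α v).2
        (mfderiv (cotangentModel E) 𝓘(ℝ, E × (E →L[ℝ] ℝ)) (cotangentCoords e) α u).1 -
      (mfderiv (cotangentModel E) 𝓘(ℝ, E × (E →L[ℝ] ℝ)) (cotangentCoords e) α u).2
        (mfderiv (cotangentModel E) 𝓘(ℝ, E × (E →L[ℝ] ℝ)) (cotangentCoords e) α v).1 := by
  set φ := extChartAt (cotangentModel E) α with hφ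
  set f : E × (E →L[ℝ] ℝ) → E × (E →L[ℝ] ℝ) := fun y => cotangentCoords e (φ.symm y) with hf
  have hα' : φ.symm (φ α) = α := extChartAt_to_inv α
  have htgt : φ.target ∈ 𝓝 (φ α) := extChartAt_target_mem_nhds α
  have hsymm : ∀ᶠ y in 𝓝 (φ α),
      ContMDiffAt 𝓘(ℝ, E × (E →L[ℝ] ℝ)) (cotangentModel E) ∞ φ.symm y := by
    have := contMDiffOn_extChartAt_symm (I := cotangentModel E) (n := ∞) α
    filter_upwards [eventually_mem_nhds_iff.2 htgt] with y hy
    exact this.contMDiffAt hy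
  have hsrc : ∀ᶠ y in 𝓝 (φ α), (φ.symm y).proj ∈ e.source := by
    have hc : ContinuousAt (fun y => (φ.symm y).proj) (φ α) :=
      (FiberBundle.continuous_proj _ _).continuousAt.comp hsymm.self_of_nhds.continuousAt
    refine hc.eventually_mem (e.open_source.mem_nhds ?_)
    rw [hα']
    exact hα
  have hfs : ContDiffAt ℝ ∞ f (φ α) := by
    rw [← contMDiffAt_iff_contDiffAt]
    exact (contMDiffAt_cotangentCoords he (α := φ.symm (φ α)) hsrc.self_of_nhds).comp (φ α)
      hsymm.self_of_nhds
  -- Near `φ α`, the Liouville form read in `φ` is the pullback of p dq by `f`.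
  have hev : (fun y => ContinuousAlternatingMap.ofSubsingleton ℝ (E × (E →L[ℝ] ℝ)) ℝ (0 : Fin 1)
        (ContinuousLinearMap.comp (liouville (φ.symm y))
          (mfderiv 𝓘(ℝ, E × (E →L[ℝ] ℝ)) (cotangentModel E) φ.symm y))) =ᶠ[𝓝 (φ α)]
      fun y => (ContinuousAlternatingMap.ofSubsingleton ℝ
        (E × (E →L[ℝ] ℝ)) ℝ (0 : Fin 1) ((f y).2.comp
          (ContinuousLinearMap.fst ℝ E (E →L[ℝ] ℝ)))).compContinuousLinearMap (fderiv ℝ f y) := by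
    filter_upwards [hsymm, hsrc] with y hy hy'
    ext c
    have hc : fderiv ℝ f y (c 0) =
        mfderiv (cotangentModel E) 𝓘(ℝ, E × (E →L[ℝ] ℝ)) (cotangentCoords e) (φ.symm y)
          (mfderiv 𝓘(ℝ, E × (E →L[ℝ] ℝ)) (cotangentModel E) φ.symm y (c 0)) := by
      rw [← mfderiv_eq_fderiv]
      have := mfderiv_comp y
        ((contMDiffAt_cotangentCoords he hy').mdifferentiableAt (by simp))
        (hy.mdifferentiableAt (by simp))
      exact DFunLike.congr_fun this (c 0)
    have := liouville_eq he hy' (mfderiv 𝓘(ℝ, E × (E →L[ℝ] ℝ)) (cotangentModel E) φ.symm y (c 0))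
    rw [← hc] at this
    exact this
  have hdf : ∀ c : TangentSpace (cotangentModel E) α, fderiv ℝ f (φ α)
      (mfderiv (cotangentModel E) 𝓘(ℝ, E × (E →L[ℝ] ℝ)) φ α c) =
      mfderiv (cotangentModel E) 𝓘(ℝ, E × (E →L[ℝ] ℝ)) (cotangentCoords e) α c := by
    intro c
    rw [← mfderiv_eq_fderiv]
    have hd : MDifferentiableAt 𝓘(ℝ, E × (E →L[ℝ] ℝ)) 𝓘(ℝ, E × (E →L[ℝ] ℝ)) f (φ α) :=
      (hfs.differentiableAt (by simp)).mdifferentiableAt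
    have h1 := mfderiv_comp α hd (mdifferentiableAt_extChartAt (I := cotangentModel E)
      (mem_chart_source _ α))
    have h2 : f ∘ φ =ᶠ[𝓝 α] cotangentCoords e := by
      filter_upwards [extChartAt_source_mem_nhds (I := cotangentModel E) α] with β hβ
      exact congrArg (cotangentCoords e) (φ.left_inv hβ)
    rw [h2.mfderiv_eq] at h1
    exact (DFunLike.congr_fun h1 c).symm
  have hω : DifferentiableAt ℝ (fun y : E × (E →L[ℝ] ℝ) => ContinuousAlternatingMap.ofSubsingleton ℝ
      (E × (E →L[ℝ] ℝ)) ℝ (0 : Fin 1) (y.2.comp (ContinuousLinearMap.fst ℝ E (E →L[ℝ] ℝ))))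
      (f (φ α)) := by
    have : DifferentiableAt ℝ (fun y : E × (E →L[ℝ] ℝ) =>
        y.2.comp (ContinuousLinearMap.fst ℝ E (E →L[ℝ] ℝ))) (f (φ α)) := by fun_prop
    exact differentiableAt_ofSubsingleton this
  have hpull := extDeriv_pullback hω hfs (r := ∞) (by
    rw [minSmoothness_of_isRCLikeNormedField]
    exact WithTop.coe_le_coe.2 (le_top : (2 : ℕ∞) ≤ ⊤))
  have : extDerivOneForm (cotangentModel E) liouville α u v =
      (mfderiv (cotangentModel E) 𝓘(ℝ, E × (E →L[ℝ] ℝ)) (cotangentCoords e) α u).2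
        (mfderiv (cotangentModel E) 𝓘(ℝ, E × (E →L[ℝ] ℝ)) (cotangentCoords e) α v).1 -
      (mfderiv (cotangentModel E) 𝓘(ℝ, E × (E →L[ℝ] ℝ)) (cotangentCoords e) α v).2
        (mfderiv (cotangentModel E) 𝓘(ℝ, E × (E →L[ℝ] ℝ)) (cotangentCoords e) α u).1 := by
    have h0 := hev.extDeriv_eq.trans hpull
    have h1 := DFunLike.congr_fun h0
      ![mfderiv (cotangentModel E) 𝓘(ℝ, E × (E →L[ℝ] ℝ)) φ α u,
        mfderiv (cotangentModel E) 𝓘(ℝ, E × (E →L[ℝ] ℝ)) φ α v]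
    refine Eq.trans h1 ?_
    rw [← hdf u, ← hdf v]
    refine Eq.trans ?_ (extDeriv_tautological (f (φ α)) _ _)
    refine congrArg (extDeriv _ (f (φ α))) (funext fun i => ?_)
    fin_cases i <;> rfl
  rw [canonicalForm, this]
  exact neg_sub _ _

end Forms

/-! ### Velocities of curves and the chain rule -/

section Curves

variable {E H N F : Type*} [NormedAddCommGroup E] [NormedSpace ℝ E] [TopologicalSpace H]
  {I : ModelWithCorners ℝ E H} [TopologicalSpace N] [ChartedSpace H N]
  [NormedAddCommGroup F] [NormedSpace ℝ F]

/-- The velocity is prescribed by an equality in the tangent bundle, as in `tangentVectors`, so base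
point and vector are substituted together and the chain rule remains. -/
theorem hasDerivAt_comp_of_velocity_eq {γ : ℝ → N} {x : N} {ξ : TangentSpace I x} {f : N → F}
    (hγ : MDifferentiableAt 𝓘(ℝ, ℝ) I γ 0)
    [IsManifold I 1 N]
    (h : (⟨γ 0, mfderiv 𝓘(ℝ, ℝ) I γ 0 (1 : ℝ)⟩ : TangentBundle I N) = ⟨x, ξ⟩)
    (hf : MDifferentiableAt I 𝓘(ℝ, F) f x) :
    HasDerivAt (f ∘ γ) (mfderiv I 𝓘(ℝ, F) f x ξ) 0 := by
  cases h
  have h1 : HasFDerivAt (f ∘ γ) (show ℝ →L[ℝ] F from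
      (mfderiv I 𝓘(ℝ, F) f (γ 0)).comp (mfderiv 𝓘(ℝ, ℝ) I γ 0)) 0 :=
    (hf.hasMFDerivAt.comp (0 : ℝ) hγ.hasMFDerivAt).hasFDerivAt
  exact h1.hasDerivAt

/-- This certifies that a curve constructed in coordinates has the intended velocity: an injective
differential lets the comparison be made after applying `f`. -/
theorem velocity_eq_of_injective [IsManifold I 1 N] {γ : ℝ → N} {x : N} {ξ : TangentSpace I x} {f : N → F}
    (hγ : MDifferentiableAt 𝓘(ℝ, ℝ) I γ 0) (h0 : γ 0 = x)
    (hf : MDifferentiableAt I 𝓘(ℝ, F) f x) (hinj : Function.Injective (mfderiv I 𝓘(ℝ, F) f x))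
    (h : HasDerivAt (f ∘ γ) (mfderiv I 𝓘(ℝ, F) f x ξ) 0) :
    (⟨γ 0, mfderiv 𝓘(ℝ, ℝ) I γ 0 (1 : ℝ)⟩ : TangentBundle I N) = ⟨x, ξ⟩ := by
  subst h0
  have h1 := hasDerivAt_comp_of_velocity_eq hγ rfl hf
  exact congrArg (fun ζ => (⟨γ 0, ζ⟩ : TangentBundle I N)) (hinj (h1.unique h))

/-- The derivative, within a set of unique differentiability, of a function along a curve. -/
theorem hasDerivWithinAt_comp_of_mdifferentiableWithinAt {w : ℝ → N} {J : Set ℝ} {t : ℝ}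
    {f : N → F} (hw : MDifferentiableWithinAt 𝓘(ℝ, ℝ) I w J t)
    (hf : MDifferentiableAt I 𝓘(ℝ, F) f (w t)) :
    HasDerivWithinAt (f ∘ w)
      (mfderiv I 𝓘(ℝ, F) f (w t) (mfderivWithin 𝓘(ℝ, ℝ) I w J t (1 : ℝ))) J t := by
  have h1 : HasFDerivWithinAt (f ∘ w) (show ℝ →L[ℝ] F from
      (mfderiv I 𝓘(ℝ, F) f (w t)).comp (mfderivWithin 𝓘(ℝ, ℝ) I w J t)) J t :=
    (hf.hasMFDerivAt.comp_hasMFDerivWithinAt t hw.hasMFDerivWithinAt).hasFDerivWithinAt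
  exact h1.hasDerivWithinAt

end Curves

/-! ### The form and the Hamiltonian on T*Q ⊕ TQ in coordinates -/

section WhitneyCoordinates

variable {E Q : Type*} [NormedAddCommGroup E] [NormedSpace ℝ E]
  [TopologicalSpace Q] [ChartedSpace E Q] [IsManifold 𝓘(ℝ, E) ∞ Q]

/-- The components `(δq, δp, δv)` of a tangent vector of `T*Q ⊕ TQ`. -/
def dCoords (e : OpenPartialHomeomorph Q E) (w : WhitneySum E Q)
    (u : TangentSpace (whitneyModel E) w) : E × (E →L[ℝ] ℝ) × E :=
  mfderiv (whitneyModel E) 𝓘(ℝ, E × (E →L[ℝ] ℝ) × E) (whitneyCoords e) w u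

variable {e : OpenPartialHomeomorph Q E} {w : WhitneySum E Q}

theorem mdifferentiableAt_whitneyCoords (he : e ∈ IsManifold.maximalAtlas 𝓘(ℝ, E) ∞ Q)
    (hw : w.proj ∈ e.source) :
    MDifferentiableAt (whitneyModel E) 𝓘(ℝ, E × (E →L[ℝ] ℝ) × E) (whitneyCoords e) w :=
  (contMDiffAt_whitneyCoords he hw).mdifferentiableAt (by simp)

theorem eventually_proj_mem (hw : w.proj ∈ e.source) : ∀ᶠ w' in 𝓝 w, w'.proj ∈ e.source :=
  (FiberBundle.continuous_proj _ _).continuousAt.eventually_mem (e.open_source.mem_nhds hw)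

/-- Differentiate `ofWhitneyCoords e ∘ whitneyCoords e = id` near `w`; surjectivity comes from the
composite in the other order. -/
theorem dCoords_injective (he : e ∈ IsManifold.maximalAtlas 𝓘(ℝ, E) ∞ Q)
    (hw : w.proj ∈ e.source) : Function.Injective (dCoords e w) := by
  have h1 : MDifferentiableAt 𝓘(ℝ, E × (E →L[ℝ] ℝ) × E) (whitneyModel E) (ofWhitneyCoords e)
      (whitneyCoords e w) :=
    (contMDiffAt_ofWhitneyCoords he (e.map_source hw)).mdifferentiableAt (by simp)
  have h2 := mfderiv_comp w h1 (mdifferentiableAt_whitneyCoords he hw)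
  have h3 : ofWhitneyCoords e ∘ whitneyCoords e =ᶠ[𝓝 w] id := by
    filter_upwards [eventually_proj_mem hw] with w' hw'
    exact ofWhitneyCoords_whitneyCoords he hw'
  intro u u' huu
  have h4 : ∀ u, mfderiv (whitneyModel E) (whitneyModel E) (ofWhitneyCoords e ∘ whitneyCoords e) w u
      = mfderiv 𝓘(ℝ, E × (E →L[ℝ] ℝ) × E) (whitneyModel E) (ofWhitneyCoords e)
      (whitneyCoords e w) (dCoords e w u) := fun u => DFunLike.congr_fun h2 u
  have h5 : ∀ u : TangentSpace (whitneyModel E) w,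
      (mfderiv (whitneyModel E) (whitneyModel E) (ofWhitneyCoords e ∘ whitneyCoords e) w u :
        E × (E →L[ℝ] ℝ) × E) = u := fun u => by
    have := h3.mfderiv_eq (I := whitneyModel E) (I' := whitneyModel E)
    rw [mfderiv_id] at this
    exact DFunLike.congr_fun this u
  have h6 := (h4 u).trans ((congrArg _ huu).trans (h4 u').symm)
  exact ((h5 u).symm.trans h6).trans (h5 u')

theorem dCoords_surjective (he : e ∈ IsManifold.maximalAtlas 𝓘(ℝ, E) ∞ Q)
    (hw : w.proj ∈ e.source) : Function.Surjective (dCoords e w) := by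
  obtain ⟨y, hy, rfl⟩ : ∃ y : E × (E →L[ℝ] ℝ) × E, y.1 ∈ e.target ∧ ofWhitneyCoords e y = w :=
    ⟨_, e.map_source hw, ofWhitneyCoords_whitneyCoords he hw⟩
  have h1 : MDifferentiableAt 𝓘(ℝ, E × (E →L[ℝ] ℝ) × E) (whitneyModel E) (ofWhitneyCoords e) y :=
    (contMDiffAt_ofWhitneyCoords he hy).mdifferentiableAt (by simp)
  have h2 := mfderiv_comp y (mdifferentiableAt_whitneyCoords he hw) h1
  have h3 : whitneyCoords e ∘ ofWhitneyCoords e =ᶠ[𝓝 y] id := by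
    filter_upwards [continuousAt_fst.eventually_mem (e.open_target.mem_nhds hy)] with y' hy'
    exact whitneyCoords_ofWhitneyCoords he hy'
  have h4 := h3.mfderiv_eq (I := 𝓘(ℝ, E × (E →L[ℝ] ℝ) × E)) (I' := 𝓘(ℝ, E × (E →L[ℝ] ℝ) × E))
  rw [mfderiv_id] at h4
  intro ξ
  refine ⟨mfderiv 𝓘(ℝ, E × (E →L[ℝ] ℝ) × E) (whitneyModel E) (ofWhitneyCoords e) y ξ, ?_⟩
  exact DFunLike.congr_fun (h2.symm.trans h4) ξ

/-- In coordinates `pr₁` is (q, p, v) ↦ (q, p), so the formula for the canonical form pulls back and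
δv does not enter. This is the source of the kernel of ω. -/
theorem form_eq (he : e ∈ IsManifold.maximalAtlas 𝓘(ℝ, E) ∞ Q) (hw : w.proj ∈ e.source)
    (u v : TangentSpace (whitneyModel E) w) :
    form w u v = (dCoords e w v).2.1 (dCoords e w u).1 - (dCoords e w u).2.1 (dCoords e w v).1 := by
  have key : ∀ u : TangentSpace (whitneyModel E) w,
      mfderiv (cotangentModel E) 𝓘(ℝ, E × (E →L[ℝ] ℝ)) (cotangentCoords e) (pr₁ w)
        (mfderiv (whitneyModel E) (cotangentModel E) (pr₁ : WhitneySum E Q → Cotangent E Q) w u) =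
      ((dCoords e w u).1, (dCoords e w u).2.1) := by
    intro u
    have h1 := mfderiv_comp w
      ((contMDiffAt_cotangentCoords he (α := pr₁ w) hw).mdifferentiableAt (by simp))
      ((contMDiffAt_pr₁ w).mdifferentiableAt (by simp))
    have h2 := mfderiv_comp w
      (((ContinuousLinearMap.fst ℝ E ((E →L[ℝ] ℝ) × E)).prod ((ContinuousLinearMap.fst ℝ
        (E →L[ℝ] ℝ) E).comp (ContinuousLinearMap.snd ℝ E ((E →L[ℝ] ℝ) × E)))).mdifferentiableAt)
      (mdifferentiableAt_whitneyCoords he hw)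
    rw [ContinuousLinearMap.mfderiv_eq] at h2
    exact DFunLike.congr_fun (h1.symm.trans h2) u
  rw [form, canonicalForm_eq he (α := pr₁ w) hw, key u, key v]

theorem hamiltonian_eq (he : e ∈ IsManifold.maximalAtlas 𝓘(ℝ, E) ∞ Q) (hw : w.proj ∈ e.source)
    (L : TangentBundle 𝓘(ℝ, E) Q → ℝ) :
    hamiltonian L w = (whitneyCoords e w).2.1 (whitneyCoords e w).2.2 -
      L (ofTangentCoords e ((whitneyCoords e w).1, (whitneyCoords e w).2.2)) := by
  have h1 : ofTangentCoords e ((whitneyCoords e w).1, (whitneyCoords e w).2.2) = pr₂ w :=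
    ofTangentCoords_tangentCoords he (v := pr₂ w) hw
  have h2 : (whitneyCoords e w).2.1 (whitneyCoords e w).2.2 = covec w w.snd.2 :=
    congrArg (show E →L[ℝ] ℝ from covec w)
      (DFunLike.congr_fun (mfderiv_symm_chart_apply he hw) w.snd.2)
  rw [h1, h2, hamiltonian]

theorem contDiffAt_comp_ofTangentCoords (he : e ∈ IsManifold.maximalAtlas 𝓘(ℝ, E) ∞ Q)
    {L : TangentBundle 𝓘(ℝ, E) Q → ℝ} (hL : ContMDiff (𝓘(ℝ, E)).tangent 𝓘(ℝ, ℝ) ∞ L)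
    {y : E × E} (hy : y.1 ∈ e.target) : ContDiffAt ℝ ∞ (fun y => L (ofTangentCoords e y)) y :=
  ((hL.contMDiffAt).comp y (contMDiffAt_ofTangentCoords he hy)).contDiffAt

/-- Leibniz and chain rule for the coordinate expression p(v) - L(q, v). -/
theorem dHamiltonian_eq (he : e ∈ IsManifold.maximalAtlas 𝓘(ℝ, E) ∞ Q) (hw : w.proj ∈ e.source)
    {L : TangentBundle 𝓘(ℝ, E) Q → ℝ} (hL : ContMDiff (𝓘(ℝ, E)).tangent 𝓘(ℝ, ℝ) ∞ L)
    (u : TangentSpace (whitneyModel E) w) :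
    dHamiltonian L w u = (dCoords e w u).2.1 (whitneyCoords e w).2.2 +
      (whitneyCoords e w).2.1 (dCoords e w u).2.2 -
      fderiv ℝ (fun y => L (ofTangentCoords e y)) ((whitneyCoords e w).1, (whitneyCoords e w).2.2)
        ((dCoords e w u).1, (dCoords e w u).2.2) := by
  set h : E × (E →L[ℝ] ℝ) × E → ℝ := fun y => y.2.1 y.2.2 - L (ofTangentCoords e (y.1, y.2.2))
  set ℓ : E × E → ℝ := fun y => L (ofTangentCoords e y)
  set y := whitneyCoords e w with hy
  have hℓ : HasFDerivAt ℓ (fderiv ℝ ℓ (y.1, y.2.2)) (y.1, y.2.2) :=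
    ((contDiffAt_comp_ofTangentCoords he hL
      (y := (y.1, y.2.2)) (e.map_source hw)).differentiableAt (by simp)).hasFDerivAt
  have hlin : HasFDerivAt (fun y : E × (E →L[ℝ] ℝ) × E => (y.1, y.2.2))
      ((ContinuousLinearMap.fst ℝ E ((E →L[ℝ] ℝ) × E)).prod ((ContinuousLinearMap.snd ℝ
        (E →L[ℝ] ℝ) E).comp (ContinuousLinearMap.snd ℝ E ((E →L[ℝ] ℝ) × E)))) y :=
    ((ContinuousLinearMap.fst ℝ E ((E →L[ℝ] ℝ) × E)).prod ((ContinuousLinearMap.snd ℝ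
        (E →L[ℝ] ℝ) E).comp (ContinuousLinearMap.snd ℝ E ((E →L[ℝ] ℝ) × E)))).hasFDerivAt
  have hp : HasFDerivAt (fun y : E × (E →L[ℝ] ℝ) × E => y.2.1)
      ((ContinuousLinearMap.fst ℝ (E →L[ℝ] ℝ) E).comp
        (ContinuousLinearMap.snd ℝ E ((E →L[ℝ] ℝ) × E))) y :=
    ((ContinuousLinearMap.fst ℝ (E →L[ℝ] ℝ) E).comp
        (ContinuousLinearMap.snd ℝ E ((E →L[ℝ] ℝ) × E))).hasFDerivAt
  have hv : HasFDerivAt (fun y : E × (E →L[ℝ] ℝ) × E => y.2.2)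
      ((ContinuousLinearMap.snd ℝ (E →L[ℝ] ℝ) E).comp
        (ContinuousLinearMap.snd ℝ E ((E →L[ℝ] ℝ) × E))) y :=
    ((ContinuousLinearMap.snd ℝ (E →L[ℝ] ℝ) E).comp
        (ContinuousLinearMap.snd ℝ E ((E →L[ℝ] ℝ) × E))).hasFDerivAt
  have hh := (hp.clm_apply hv).sub (hℓ.comp y hlin)
  have hev : hamiltonian L =ᶠ[𝓝 w] h ∘ whitneyCoords e := by
    filter_upwards [eventually_proj_mem hw] with w' hw'
    exact hamiltonian_eq he hw' L
  have hcomp := hh.hasMFDerivAt.comp w (mdifferentiableAt_whitneyCoords he hw).hasMFDerivAt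
  have hfin := (hcomp.congr_of_eventuallyEq hev).mfderiv
  refine (DFunLike.congr_fun hfin u).trans ?_
  change (y.2.1 (dCoords e w u).2.2 + (dCoords e w u).2.1 y.2.2) -
    fderiv ℝ ℓ (y.1, y.2.2) ((dCoords e w u).1, (dCoords e w u).2.2) = _
  ring

end WhitneyCoordinates

/-! ### Splitting velocities into bound and free components -/

section CoordinateSpace

variable {m k : ℕ}

/-- The first `m` components of a vector. -/
def boundL : Coord m k →L[ℝ] (Fin m → ℝ) :=
  ContinuousLinearMap.pi fun α => EuclideanSpace.proj (Fin.castAdd k α)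

/-- The last `k` components of a vector. -/
def freeL : Coord m k →L[ℝ] (Fin k → ℝ) :=
  ContinuousLinearMap.pi fun a => EuclideanSpace.proj (Fin.natAdd m a)

theorem boundL_apply (v : Coord m k) (α : Fin m) : boundL v α = v (Fin.castAdd k α) := rfl

theorem freeL_apply (v : Coord m k) : freeL v = free v := rfl

/-- The map `(s, y) ↦ glue s y`, as a continuous linear map. -/
def glueL : (Fin m → ℝ) × (Fin k → ℝ) →L[ℝ] Coord m k :=
  LinearMap.toContinuousLinearMap
    { toFun := fun y => glue y.1 y.2
      map_add' := fun y y' => by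
        ext A
        refine Fin.addCases (fun α => ?_) (fun a => ?_) A <;> simp [glue]
      map_smul' := fun c y => by
        ext A
        refine Fin.addCases (fun α => ?_) (fun a => ?_) A <;> simp [glue] }

theorem glueL_apply (s : Fin m → ℝ) (y : Fin k → ℝ) : glueL (s, y) = glue s y := rfl

@[simp] theorem boundL_glue (s : Fin m → ℝ) (y : Fin k → ℝ) : boundL (glue s y) = s := by
  ext α
  simp [boundL_apply, glue]

@[simp] theorem free_glue (s : Fin m → ℝ) (y : Fin k → ℝ) : free (glue s y) = y := by
  ext a
  simp [free, glue]

theorem glue_boundL_free (v : Coord m k) : glue (boundL v) (free v) = v := by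
  ext A
  refine Fin.addCases (fun α => ?_) (fun a => ?_) A <;> simp [glue, boundL_apply, free]

theorem eq_glue_iff {v : Coord m k} {s : Fin m → ℝ} {y : Fin k → ℝ} :
    v = glue s y ↔ boundL v = s ∧ free v = y := by
  refine ⟨fun h => by simp [h], fun h => ?_⟩
  rw [← h.1, ← h.2, glue_boundL_free]

theorem clm_apply_glue (p : Coord m k →L[ℝ] ℝ) (s : Fin m → ℝ) (y : Fin k → ℝ) :
    p (glue s y) = ∑ α, p (EuclideanSpace.single (Fin.castAdd k α) 1) * s α +
      ∑ a, p (EuclideanSpace.single (Fin.natAdd m a) 1) * y a := by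
  have h : glue s y = ∑ A, (glue s y) A • EuclideanSpace.single A (1 : ℝ) := by
    ext B
    simp [Finset.sum_apply, Pi.single_apply]
  rw [h, map_sum, Fin.sum_univ_add]
  simp [glue, mul_comm]

end CoordinateSpace

theorem hasDerivAt_add_smul {F : Type*} [NormedAddCommGroup F] [NormedSpace ℝ F] (a b : F) :
    HasDerivAt (fun t : ℝ => a + t • b) b 0 := by
  simpa only [id, one_smul] using ((hasDerivAt_id (0 : ℝ)).smul_const b).const_add a

/-! ### Tangent vectors of W₀ over a constraint chart -/

namespace ConstraintChart

variable {m k : ℕ} {Q : Type*} [TopologicalSpace Q] [ChartedSpace (Coord m k) Q]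
  [IsManifold 𝓘(ℝ, Coord m k) ∞ Q]
  {M : Set (TangentBundle 𝓘(ℝ, Coord m k) Q)} (C : ConstraintChart M)
  {w : WhitneySum (Coord m k) Q}

theorem proj_mem {C : ConstraintChart M} (hU : pr₂ w ∈ C.U) : w.proj ∈ C.e.source :=
  C.U_subset _ hU

theorem coords_eq : C.coords w = ((whitneyCoords C.e w).1, freeL (whitneyCoords C.e w).2.2) := rfl

theorem mem_W₀_iff {C : ConstraintChart M} (hU : pr₂ w ∈ C.U) : w ∈ W₀ M ↔
    C.coords w ∈ C.O ∧ boundL (whitneyCoords C.e w).2.2 = C.Ψ (C.coords w) := by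
  refine (C.mem_iff _ hU).trans (and_congr Iff.rfl ?_)
  rw [funext_iff]
  rfl

theorem tangentOf_mem {z : Coord m k × (Fin k → ℝ)} (hz : z ∈ C.O) :
    tangentOf C.e z.1 (glue (C.Ψ z) z.2) ∈ M := by
  obtain ⟨h1, h2⟩ := C.graph_mem z hz
  have h3 : C.e (tangentOf C.e z.1 (glue (C.Ψ z) z.2)).proj = z.1 := C.e.right_inv h1
  have h4 : vel C.e (tangentOf C.e z.1 (glue (C.Ψ z) z.2)) = glue (C.Ψ z) z.2 :=
    congrArg (Prod.snd : Coord m k × Coord m k → Coord m k)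
      (tangentCoords_ofTangentCoords C.e_mem (y := (z.1, glue (C.Ψ z) z.2)) h1)
  refine (C.mem_iff _ h2).2 ?_
  rw [h3, h4, free_glue]
  refine ⟨hz, fun α => ?_⟩
  rw [← boundL_apply, boundL_glue]

theorem contDiffAt_Ψ {z : Coord m k × (Fin k → ℝ)} (hz : z ∈ C.O) : ContDiffAt ℝ ∞ C.Ψ z :=
  C.smooth_Ψ.contDiffAt (C.isOpen_O.mem_nhds hz)

/-- The point of `W₀` with coordinates `q`, `q̇^a` and momentum `p`. -/
def lift (z : Coord m k × (Fin k → ℝ)) (p : Coord m k →L[ℝ] ℝ) : WhitneySum (Coord m k) Q :=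
  ofWhitneyCoords C.e (z.1, p, glue (C.Ψ z) z.2)

theorem whitneyCoords_lift {z : Coord m k × (Fin k → ℝ)} (hz : z ∈ C.O) (p : Coord m k →L[ℝ] ℝ) :
    whitneyCoords C.e (C.lift z p) = (z.1, p, glue (C.Ψ z) z.2) :=
  whitneyCoords_ofWhitneyCoords C.e_mem (C.graph_mem z hz).1

theorem lift_coords (hw : w ∈ W₀ M) (hU : pr₂ w ∈ C.U) :
    C.lift (C.coords w) (whitneyCoords C.e w).2.1 = w := by
  have h := (mem_W₀_iff hU).1 hw
  conv_rhs => rw [← ofWhitneyCoords_whitneyCoords C.e_mem (proj_mem hU)]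
  rw [lift, ← h.2]
  congr 1
  exact congrArg (fun v => ((whitneyCoords C.e w).1, (whitneyCoords C.e w).2.1, v))
    (glue_boundL_free _)

theorem contDiffAt_lift_coords {z : Coord m k × (Fin k → ℝ)} (hz : z ∈ C.O)
    (p : Coord m k →L[ℝ] ℝ) :
    ContMDiffAt 𝓘(ℝ, (Coord m k × (Fin k → ℝ)) × (Coord m k →L[ℝ] ℝ)) (whitneyModel (Coord m k)) ∞
      (fun y : (Coord m k × (Fin k → ℝ)) × (Coord m k →L[ℝ] ℝ) => C.lift y.1 y.2) (z, p) := by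
  have h : ContDiffAt ℝ ∞ (fun y : (Coord m k × (Fin k → ℝ)) × (Coord m k →L[ℝ] ℝ) =>
      (y.1.1, y.2, glueL (C.Ψ y.1, y.1.2))) (z, p) := by
    have hΨ : ContDiffAt ℝ ∞ (fun y : (Coord m k × (Fin k → ℝ)) × (Coord m k →L[ℝ] ℝ) =>
        C.Ψ y.1) (z, p) := (C.contDiffAt_Ψ hz).comp (z, p) contDiffAt_fst
    have h2 := glueL.contDiff.contDiffAt.comp (z, p) (hΨ.prodMk contDiffAt_fst.snd)
    exact contDiffAt_fst.fst.prodMk (contDiffAt_snd.prodMk h2)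
  exact (contMDiffAt_ofWhitneyCoords C.e_mem (y := (z.1, p, glue (C.Ψ z) z.2))
    (C.graph_mem z hz).1).comp (z, p) h.contMDiffAt

/-- Differentiating the graph relation along a curve in W₀ gives the linear relation. Conversely,
(q, q̇^a, p) parametrize W₀ over `C.U`, and a straight line in these parameters realizes any vector
that satisfies the relation. -/
theorem mem_tangentVectors_iff (hw : w ∈ W₀ M) (hU : pr₂ w ∈ C.U)
    (X : TangentSpace (whitneyModel (Coord m k)) w) :
    X ∈ tangentVectors (whitneyModel (Coord m k)) (W₀ M) w ↔
      boundL (dCoords C.e w X).2.2 =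
        fderiv ℝ C.Ψ (C.coords w) ((dCoords C.e w X).1, freeL (dCoords C.e w X).2.2) := by
  have hz := ((mem_W₀_iff hU).1 hw).1
  have hK := mdifferentiableAt_whitneyCoords C.e_mem (proj_mem hU)
  have hΨ : HasFDerivAt C.Ψ (fderiv ℝ C.Ψ (C.coords w)) (C.coords w) :=
    ((C.contDiffAt_Ψ hz).differentiableAt (by simp)).hasFDerivAt
  constructor
  · rintro ⟨γ, hγ, hS, h⟩
    have hd := hasDerivAt_comp_of_velocity_eq (hγ.mdifferentiableAt (by simp)) h hK
    change HasDerivAt _ (dCoords C.e w X) 0 at hd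
    have h0 : γ 0 = w := congrArg TotalSpace.proj h
    have hev : ∀ᶠ t in 𝓝 (0 : ℝ), pr₂ (γ t) ∈ C.U := by
      have hc : ContinuousAt (fun t => pr₂ (γ t)) 0 :=
        (contMDiffAt_pr₂ (γ 0)).continuousAt.comp hγ.continuousAt
      refine hc.eventually_mem (C.isOpen_U.mem_nhds ?_)
      rw [h0]
      exact hU
    have h1 : HasDerivAt (fun t => (C.coords (γ t)))
        ((dCoords C.e w X).1, freeL (dCoords C.e w X).2.2) 0 :=
      hd.fst.prodMk (freeL.hasFDerivAt.comp_hasDerivAt (0 : ℝ) hd.snd.snd)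
    have h2 : HasDerivAt (fun t => boundL (whitneyCoords C.e (γ t)).2.2)
        (boundL (dCoords C.e w X).2.2) 0 := boundL.hasFDerivAt.comp_hasDerivAt (0 : ℝ) hd.snd.snd
    have h3 := hΨ.comp_hasDerivAt_of_eq (0 : ℝ) h1 (by rw [h0])
    refine h2.unique (h3.congr_of_eventuallyEq ?_)
    filter_upwards [hev, hS] with t ht ht'
    exact ((mem_W₀_iff ht).1 ht').2
  · intro hX
    set ξ := dCoords C.e w X with hξ
    -- A straight line in the parameters; since `C.O` is open, its lift lies in W₀ for small times.
    set z : ℝ → Coord m k × (Fin k → ℝ) := fun t => C.coords w + t • (ξ.1, freeL ξ.2.2) with hzt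
    set p : ℝ → Coord m k →L[ℝ] ℝ := fun t => (whitneyCoords C.e w).2.1 + t • ξ.2.1 with hp
    have z0 : z 0 = C.coords w := by simp [hzt]
    have p0 : p 0 = (whitneyCoords C.e w).2.1 := by simp [hp]
    have hzd : HasDerivAt z (ξ.1, freeL ξ.2.2) 0 :=
      hasDerivAt_add_smul _ _
    have hpd : HasDerivAt p ξ.2.1 0 :=
      hasDerivAt_add_smul _ _
    have hzO : ∀ᶠ t in 𝓝 (0 : ℝ), z t ∈ C.O :=
      hzd.continuousAt.eventually_mem (C.isOpen_O.mem_nhds (by rw [z0]; exact hz))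
    have hγ : ContMDiffAt 𝓘(ℝ, ℝ) (whitneyModel (Coord m k)) ∞ (fun t => C.lift (z t) (p t)) 0 := by
      have hs : ContDiff ℝ ∞ (fun t => (z t, p t)) := by
        simp only [hzt, hp]
        fun_prop
      exact ContMDiffAt.comp (g := fun y : (Coord m k × (Fin k → ℝ)) × (Coord m k →L[ℝ] ℝ) =>
        C.lift y.1 y.2) (0 : ℝ) (C.contDiffAt_lift_coords hzO.self_of_nhds (p 0))
        hs.contMDiff.contMDiffAt
    refine ⟨fun t => C.lift (z t) (p t), hγ, ?_, ?_⟩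
    · filter_upwards [hzO] with t ht
      exact C.tangentOf_mem ht
    · refine velocity_eq_of_injective (hγ.mdifferentiableAt (by simp)) ?_ hK
        (dCoords_injective C.e_mem (proj_mem hU)) ?_
      · rw [z0, p0, C.lift_coords hw hU]
      · change HasDerivAt _ ξ 0
        have h1 := hΨ.comp_hasDerivAt_of_eq (0 : ℝ) hzd z0.symm
        rw [← hX] at h1
        have hz1 : HasDerivAt (fun t => (z t).1) ξ.1 0 := hzd.fst
        have hz2 : HasDerivAt (fun t => (z t).2) (freeL ξ.2.2) 0 := hzd.snd
        have h2 := glueL.hasFDerivAt.comp_hasDerivAt (0 : ℝ) (h1.prodMk hz2)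
        have h3 : HasDerivAt (fun t => ((z t).1, p t, glueL (C.Ψ (z t), (z t).2))) _ 0 :=
          hz1.prodMk (hpd.prodMk h2)
        have h4 : ξ = (ξ.1, ξ.2.1, glueL (boundL ξ.2.2, freeL ξ.2.2)) := by
          rw [glueL_apply, freeL_apply, glue_boundL_free]
        rw [h4]
        refine h3.congr_of_eventuallyEq ?_
        filter_upwards [hzO] with t ht
        exact C.whitneyCoords_lift ht _

end ConstraintChart

/-! ### The equation i_X ω = dH at a point, and the set W₁ -/

namespace ConstraintChart

variable {m k : ℕ} {Q : Type*} [TopologicalSpace Q] [ChartedSpace (Coord m k) Q]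
  [IsManifold 𝓘(ℝ, Coord m k) ∞ Q]
  {M : Set (TangentBundle 𝓘(ℝ, Coord m k) Q)} (C : ConstraintChart M)
  {L : TangentBundle 𝓘(ℝ, Coord m k) Q → ℝ} {w : WhitneySum (Coord m k) Q}

theorem restrictedL_eq (L : TangentBundle 𝓘(ℝ, Coord m k) Q → ℝ) : C.restrictedL L =
    fun z => (fun y => L (ofTangentCoords C.e y)) (z.1, glueL (C.Ψ z, z.2)) := rfl

theorem contDiffAt_restrictedL (hL : ContMDiff (𝓘(ℝ, Coord m k)).tangent 𝓘(ℝ, ℝ) ∞ L)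
    {z : Coord m k × (Fin k → ℝ)} (hz : z ∈ C.O) : ContDiffAt ℝ ∞ (C.restrictedL L) z := by
  have h1 := contDiffAt_comp_ofTangentCoords C.e_mem hL (y := (z.1, glueL (C.Ψ z, z.2)))
    (C.graph_mem z hz).1
  rw [restrictedL_eq]
  exact ContDiffAt.comp (g := fun y => L (ofTangentCoords C.e y)) z h1
    (contDiffAt_fst.prodMk (glueL.contDiff.contDiffAt.comp z
      ((C.contDiffAt_Ψ hz).prodMk contDiffAt_snd)))

theorem fderiv_restrictedL (hL : ContMDiff (𝓘(ℝ, Coord m k)).tangent 𝓘(ℝ, ℝ) ∞ L)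
    {z : Coord m k × (Fin k → ℝ)} (hz : z ∈ C.O) (u : Coord m k × (Fin k → ℝ)) :
    fderiv ℝ (C.restrictedL L) z u = fderiv ℝ (fun y => L (ofTangentCoords C.e y))
      (z.1, glue (C.Ψ z) z.2) (u.1, glue (fderiv ℝ C.Ψ z u) u.2) := by
  have h1 := ((contDiffAt_comp_ofTangentCoords C.e_mem hL (y := (z.1, glueL (C.Ψ z, z.2)))
    (C.graph_mem z hz).1).differentiableAt (by simp)).hasFDerivAt
  have h2 := ((C.contDiffAt_Ψ hz).differentiableAt (by simp)).hasFDerivAt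
  have h3 := glueL.hasFDerivAt.comp z (h2.prodMk hasFDerivAt_snd)
  have h4 := HasFDerivAt.comp z h1 (hasFDerivAt_fst.prodMk h3)
  exact DFunLike.congr_fun h4.fderiv u

/-- On vectors tangent to W₀, δv is the differential of the graph map, so the derivative of L
collapses to that of L̃: the extension of L̃ off M plays no role. -/
theorem dHamiltonian_tangent (hL : ContMDiff (𝓘(ℝ, Coord m k)).tangent 𝓘(ℝ, ℝ) ∞ L)
    (hw : w ∈ W₀ M) (hU : pr₂ w ∈ C.U) {V : TangentSpace (whitneyModel (Coord m k)) w}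
    (hV : V ∈ tangentVectors (whitneyModel (Coord m k)) (W₀ M) w) :
    dHamiltonian L w V = (dCoords C.e w V).2.1 (whitneyCoords C.e w).2.2 +
      (whitneyCoords C.e w).2.1 (glue (fderiv ℝ C.Ψ (C.coords w)
        ((dCoords C.e w V).1, freeL (dCoords C.e w V).2.2)) (freeL (dCoords C.e w V).2.2)) -
      fderiv ℝ (C.restrictedL L) (C.coords w)
        ((dCoords C.e w V).1, freeL (dCoords C.e w V).2.2) := by
  have hz := (mem_W₀_iff hU).1 hw
  rw [dHamiltonian_eq C.e_mem (proj_mem hU) hL, C.fderiv_restrictedL hL hz.1]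
  have h1 := (C.mem_tangentVectors_iff hw hU V).1 hV
  have h2 : glue (fderiv ℝ C.Ψ (C.coords w) ((dCoords C.e w V).1, freeL (dCoords C.e w V).2.2))
      (freeL (dCoords C.e w V).2.2) = (dCoords C.e w V).2.2 :=
    (eq_glue_iff.2 ⟨h1, rfl⟩).symm
  have h3 : glue (C.Ψ (C.coords w)) (C.coords w).2 = (whitneyCoords C.e w).2.2 :=
    (eq_glue_iff.2 ⟨hz.2, rfl⟩).symm
  simp only [h2, h3]
  rfl

/-- The variations of q, p and q̇^a are independent, so that the equation may be tested on each of
them separately. -/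
theorem exists_tangentVector (hw : w ∈ W₀ M) (hU : pr₂ w ∈ C.U) (a : Coord m k)
    (η : Coord m k →L[ℝ] ℝ) (y : Fin k → ℝ) :
    ∃ V ∈ tangentVectors (whitneyModel (Coord m k)) (W₀ M) w, (dCoords C.e w V).1 = a ∧
      (dCoords C.e w V).2.1 = η ∧ freeL (dCoords C.e w V).2.2 = y := by
  obtain ⟨V, hV⟩ := dCoords_surjective C.e_mem (proj_mem hU)
    (a, η, glue (fderiv ℝ C.Ψ (C.coords w) (a, y)) y)
  refine ⟨V, (C.mem_tangentVectors_iff hw hU V).2 ?_, ?_⟩ <;> rw [hV] <;> simp [freeL_apply]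

/-- The right side says that dH vanishes on variations of the free velocities alone; the basis
vectors `Pi.single a 1` give back the individual equations. -/
theorem momentumEquations_iff (hw : w ∈ W₀ M) (hU : pr₂ w ∈ C.U) : C.MomentumEquations L w ↔
      ∀ y : Fin k → ℝ, (whitneyCoords C.e w).2.1 (glue (fderiv ℝ C.Ψ (C.coords w) (0, y)) y) =
        fderiv ℝ (C.restrictedL L) (C.coords w) (0, y) := by
  have hz := ((mem_W₀_iff hU).1 hw).1
  have hΨ : ∀ α a, dqdot (fun z => C.Ψ z α) a (C.coords w) =
      fderiv ℝ C.Ψ (C.coords w) (0, Pi.single a 1) α := by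
    intro α a
    rw [dqdot, fderiv_apply ((C.contDiffAt_Ψ hz).differentiableAt (by simp))]
    rfl
  have hbasis : ∀ a, (whitneyCoords C.e w).2.1 (glue
      (fderiv ℝ C.Ψ (C.coords w) (0, Pi.single a 1)) (Pi.single a 1)) =
      ∑ α : Fin m, mom C.e w (Fin.castAdd k α) * dqdot (fun z => C.Ψ z α) a (C.coords w) +
        mom C.e w (Fin.natAdd m a) := by
    intro a
    rw [clm_apply_glue]
    simp only [hΨ]
    simp [Pi.single_apply]
    rfl
  have hiff : C.MomentumEquations L w ↔ ∀ a, (whitneyCoords C.e w).2.1 (glue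
      (fderiv ℝ C.Ψ (C.coords w) (0, Pi.single a 1)) (Pi.single a 1)) =
      fderiv ℝ (C.restrictedL L) (C.coords w) (0, Pi.single a 1) := by
    refine forall_congr' fun a => ?_
    rw [hbasis, eq_sub_iff_add_eq, add_comm]
    rfl
  rw [hiff]
  refine ⟨fun h => ?_, fun h a => h _⟩
  have hlin : ((whitneyCoords C.e w).2.1.comp (glueL.comp (((fderiv ℝ C.Ψ (C.coords w)).comp
      (ContinuousLinearMap.inr ℝ _ _)).prod (ContinuousLinearMap.id ℝ _)))).toLinearMap =
      ((fderiv ℝ (C.restrictedL L) (C.coords w)).comp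
        (ContinuousLinearMap.inr ℝ _ _)).toLinearMap := by
    refine LinearMap.pi_ext' fun a => ?_
    ext
    exact h a
  exact fun y => DFunLike.congr_fun hlin y


/-- Both sides of i_X ω = dH are linear in the test vector, and each kind of variation yields one
condition. The q̇^a-components of X do not occur in any of them. -/
theorem solvesAt_iff (hL : ContMDiff (𝓘(ℝ, Coord m k)).tangent 𝓘(ℝ, ℝ) ∞ L)
    (hw : w ∈ W₀ M) (hU : pr₂ w ∈ C.U) (X : TangentSpace (whitneyModel (Coord m k)) w) :
    SolvesAt L M w X ↔ X ∈ tangentVectors (whitneyModel (Coord m k)) (W₀ M) w ∧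
      C.MomentumEquations L w ∧ (dCoords C.e w X).1 = (whitneyCoords C.e w).2.2 ∧
      ∀ a, (dCoords C.e w X).2.1 a = fderiv ℝ (C.restrictedL L) (C.coords w) (a, 0) -
        (whitneyCoords C.e w).2.1 (glue (fderiv ℝ C.Ψ (C.coords w) (a, 0)) 0) := by
  have hglue : ∀ a : Coord m k, ∀ y : Fin k → ℝ,
      glue (fderiv ℝ C.Ψ (C.coords w) (a, y)) y = glue (fderiv ℝ C.Ψ (C.coords w) (a, 0)) 0 +
        glue (fderiv ℝ C.Ψ (C.coords w) (0, y)) y := by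
    intro a y
    rw [← glueL_apply, ← glueL_apply, ← glueL_apply, ← map_add, Prod.mk_add_mk, ← map_add]
    simp
  have hℓ : ∀ a : Coord m k, ∀ y : Fin k → ℝ,
      fderiv ℝ (C.restrictedL L) (C.coords w) (a, y) =
        fderiv ℝ (C.restrictedL L) (C.coords w) (a, 0) +
        fderiv ℝ (C.restrictedL L) (C.coords w) (0, y) := by
    intro a y
    rw [← map_add]
    simp
  rw [SolvesAt, C.momentumEquations_iff hw hU]
  refine and_congr_right fun hX => ⟨fun h => ?_, fun ⟨h1, h2, h3⟩ V hV => ?_⟩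
  -- The equation on the test vector with δq = a, δp = η, δq̇^a = y. Setting two of the three to
  -- zero isolates each condition.
  · have key : ∀ (a : Coord m k) (η : Coord m k →L[ℝ] ℝ) (y : Fin k → ℝ),
        η (dCoords C.e w X).1 - (dCoords C.e w X).2.1 a =
          η (whitneyCoords C.e w).2.2 +
          (whitneyCoords C.e w).2.1 (glue (fderiv ℝ C.Ψ (C.coords w) (a, y)) y) -
          fderiv ℝ (C.restrictedL L) (C.coords w) (a, y) := by
      intro a η y
      obtain ⟨V, hV, rfl, rfl, rfl⟩ := C.exists_tangentVector hw hU a η y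
      rw [← form_eq C.e_mem (proj_mem hU), ← C.dHamiltonian_tangent hL hw hU hV]
      exact h V hV
    have hzero : glue (0 : Fin m → ℝ) (0 : Fin k → ℝ) = (0 : Coord m k) := map_zero glueL
    refine ⟨fun y => ?_, ?_, fun a => ?_⟩
    · have := key 0 0 y
      simp only [map_zero, zero_apply] at this
      linarith
    · ext A
      have := key 0 (EuclideanSpace.proj A) 0
      rw [show ((0 : Coord m k), (0 : Fin k → ℝ)) = 0 from rfl] at this
      simpa [hzero] using this
    · have := key a 0 0
      simp only [zero_apply] at this
      linarith
  · rw [form_eq C.e_mem (proj_mem hU), C.dHamiltonian_tangent hL hw hU hV, h2, h3,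
      hglue _ (freeL (dCoords C.e w V).2.2), map_add, h1,
      hℓ (dCoords C.e w V).1 (freeL (dCoords C.e w V).2.2)]
    ring

theorem mem_W₁_iff (hL : ContMDiff (𝓘(ℝ, Coord m k)).tangent 𝓘(ℝ, ℝ) ∞ L)
    (hw : w ∈ W₀ M) (hU : pr₂ w ∈ C.U) : w ∈ W₁ L M ↔ C.MomentumEquations L w := by
  constructor
  · rintro ⟨-, X, hX⟩
    exact ((C.solvesAt_iff hL hw hU X).1 hX).2.1
  · intro h
    -- The first two components of X are dictated by `solvesAt_iff`; its free velocity components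
    -- are arbitrary and taken to be 0.
    obtain ⟨X, hX, h1, h2, -⟩ := C.exists_tangentVector hw hU (whitneyCoords C.e w).2.2
      ((fderiv ℝ (C.restrictedL L) (C.coords w)).comp (ContinuousLinearMap.inl ℝ _ _) -
        (whitneyCoords C.e w).2.1.comp (glueL.comp (((fderiv ℝ C.Ψ (C.coords w)).comp
          (ContinuousLinearMap.inl ℝ _ _)).prod 0))) 0
    refine ⟨hw, X, (C.solvesAt_iff hL hw hU X).2 ⟨hX, h, h1, fun a => ?_⟩⟩
    rw [h2]
    rfl

/-- If X solves the equation, then dH(V) = ω(X, V) = -ω(V, X) vanishes for V in the kernel.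
Conversely, vectors with δq = 0 and δp = 0 lie in the kernel, and on these alone dH = 0 already
amounts to the momentum equations. -/
theorem mem_W₁_iff_kerForm (hL : ContMDiff (𝓘(ℝ, Coord m k)).tangent 𝓘(ℝ, ℝ) ∞ L)
    (hw : w ∈ W₀ M) (hU : pr₂ w ∈ C.U) :
    w ∈ W₁ L M ↔ ∀ V ∈ kerForm M w, dHamiltonian L w V = 0 := by
  constructor
  · rintro ⟨-, X, hX, h⟩ V ⟨hV, hker⟩
    have h1 := hker X hX
    rw [form_eq C.e_mem (proj_mem hU)] at h1
    rw [← h V hV, form_eq C.e_mem (proj_mem hU)]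
    linarith
  · intro h
    rw [C.mem_W₁_iff hL hw hU, C.momentumEquations_iff hw hU]
    intro y
    obtain ⟨V, hV, h1, h2, h3⟩ := C.exists_tangentVector hw hU 0 0 y
    have h4 := h V ⟨hV, fun U _ => by rw [form_eq C.e_mem (proj_mem hU), h1, h2]; simp⟩
    rw [C.dHamiltonian_tangent hL hw hU hV, h1, h2, h3] at h4
    simp only [zero_apply] at h4
    linarith

end ConstraintChart

/-! ### Velocities on an interval, and momenta as components -/

/-- A nondegenerate interval is convex with nonempty interior. This makes derivatives within `J`
unique, also at end points. -/
theorem uniqueDiffOn_of_ordConnected {J : Set ℝ} (hJ : J.OrdConnected) (hJ' : J.Nontrivial) :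
    UniqueDiffOn ℝ J := by
  obtain ⟨a, ha, b, hb, hab⟩ := hJ'.exists_lt
  refine uniqueDiffOn_convex hJ.convex ?_
  obtain ⟨c, hc⟩ := nonempty_Ioo.2 hab
  exact ⟨c, mem_interior.2 ⟨Ioo a b, Ioo_subset_Icc_self.trans (hJ.out ha hb), isOpen_Ioo, hc⟩⟩

section Velocity

variable {E Q : Type*} [NormedAddCommGroup E] [NormedSpace ℝ E]
  [TopologicalSpace Q] [ChartedSpace E Q]
  {e : OpenPartialHomeomorph Q E}

theorem tangentCoords_velocity (he : e ∈ IsManifold.maximalAtlas 𝓘(ℝ, E) ∞ Q) {c : ℝ → Q}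
    {J : Set ℝ} {t : ℝ} (hJ : UniqueDiffWithinAt ℝ J t)
    (hc : MDifferentiableWithinAt 𝓘(ℝ, ℝ) 𝓘(ℝ, E) c J t) (ht : c t ∈ e.source) :
    tangentCoords e (velocity 𝓘(ℝ, E) c J t) = (e (c t), derivWithin (fun s => e (c s)) J t) :=
  Prod.ext rfl ((hasDerivWithinAt_comp_of_mdifferentiableWithinAt hc
    ((contMDiffAt_of_mem_maximalAtlas he ht).mdifferentiableAt (by simp))).derivWithin hJ).symm

theorem mdifferentiableWithinAt_of_chart (he : e ∈ IsManifold.maximalAtlas 𝓘(ℝ, E) ∞ Q)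
    {c : ℝ → Q} {J : Set ℝ} {t : ℝ} (ht : t ∈ J) (hc : ∀ s ∈ J, c s ∈ e.source)
    (hx : DifferentiableWithinAt ℝ (fun s => e (c s)) J t) :
    MDifferentiableWithinAt 𝓘(ℝ, ℝ) 𝓘(ℝ, E) c J t := by
  have h1 : MDifferentiableAt 𝓘(ℝ, E) 𝓘(ℝ, E) e.symm (e (c t)) :=
    (contMDiffAt_symm_of_mem_maximalAtlas he (e.map_source (hc t ht))).mdifferentiableAt (by simp)
  refine (h1.comp_mdifferentiableWithinAt t hx.mdifferentiableWithinAt).congr (fun s hs => ?_) ?_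
  · exact (e.left_inv (hc s hs)).symm
  · exact (e.left_inv (hc t ht)).symm

variable [IsManifold 𝓘(ℝ, E) ∞ Q]

/-- Tangent coordinates are injective over the chart, so an equality in TQ reduces to one between
vectors of the model space. -/
theorem eq_velocity_iff (he : e ∈ IsManifold.maximalAtlas 𝓘(ℝ, E) ∞ Q) {c : ℝ → Q}
    {J : Set ℝ} {t : ℝ} (hJ : UniqueDiffWithinAt ℝ J t)
    (hc : MDifferentiableWithinAt 𝓘(ℝ, ℝ) 𝓘(ℝ, E) c J t) (ht : c t ∈ e.source)
    {v : TangentBundle 𝓘(ℝ, E) Q} (hv : v.proj = c t) :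
    v = velocity 𝓘(ℝ, E) c J t ↔ (tangentCoords e v).2 = derivWithin (fun s => e (c s)) J t := by
  have h := tangentCoords_velocity he hJ hc ht
  constructor
  · rintro rfl
    rw [h]
  · intro h'
    rw [← ofTangentCoords_tangentCoords he (v := v) (by rw [hv]; exact ht),
      ← ofTangentCoords_tangentCoords he (v := velocity 𝓘(ℝ, E) c J t) ht, h, ← h', ← hv]
    rfl

end Velocity

section Momenta

variable {m k : ℕ}

theorem clm_eq_sum (p : Coord m k →L[ℝ] ℝ) :
    p = ∑ A, p (EuclideanSpace.single A 1) • (EuclideanSpace.proj A : Coord m k →L[ℝ] ℝ) := by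
  ext v
  have h : v = ∑ A, v A • EuclideanSpace.single A (1 : ℝ) := by
    ext B
    simp [Finset.sum_apply, Pi.single_apply]
  conv_lhs => rw [h]
  simp [mul_comm]

theorem differentiableAt_dqdot {f : Coord m k × (Fin k → ℝ) → ℝ} {z : Coord m k × (Fin k → ℝ)}
    (hf : ContDiffAt ℝ ∞ f z) (a : Fin k) : DifferentiableAt ℝ (dqdot f a) z :=
  ((hf.fderiv_right (m := ∞) (by simp)).differentiableAt (by simp)).clm_apply
    (differentiableAt_const _)

end Momenta

/-! ### The equation along a curve -/

namespace ConstraintChart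

variable {m k : ℕ} {Q : Type*} [TopologicalSpace Q] [ChartedSpace (Coord m k) Q]
  [IsManifold 𝓘(ℝ, Coord m k) ∞ Q]
  {M : Set (TangentBundle 𝓘(ℝ, Coord m k) Q)} (C : ConstraintChart M)
  {L : TangentBundle 𝓘(ℝ, Coord m k) Q → ℝ} {w : ℝ → WhitneySum (Coord m k) Q} {J : Set ℝ} {t : ℝ}

theorem contDiffAt_Ψ_apply {z : Coord m k × (Fin k → ℝ)} (hz : z ∈ C.O) (α : Fin m) :
    ContDiffAt ℝ ∞ (fun z => C.Ψ z α) z :=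
  contDiffAt_pi.1 (C.contDiffAt_Ψ hz) α

theorem hasDerivWithinAt_whitneyCoords
    (hU : pr₂ (w t) ∈ C.U)
    (hd : MDifferentiableWithinAt 𝓘(ℝ, ℝ) (whitneyModel (Coord m k)) w J t) :
    HasDerivWithinAt (fun s => whitneyCoords C.e (w s)) (dCoords C.e (w t)
      (mfderivWithin 𝓘(ℝ, ℝ) (whitneyModel (Coord m k)) w J t (1 : ℝ))) J t :=
  hasDerivWithinAt_comp_of_mdifferentiableWithinAt hd
    (mdifferentiableAt_whitneyCoords C.e_mem (proj_mem hU))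

/-- The curve is only differentiable, and only one-sided at an end point, so it is not itself a
witness for `tangentVectors`. Instead the graph relation is differentiated within `J`, which gives
the linear criterion. -/
theorem velocity_mem_tangentVectors (hJ : UniqueDiffWithinAt ℝ J t) (ht : t ∈ J)
    (hw : ∀ t ∈ J, w t ∈ W₀ M ∧ pr₂ (w t) ∈ C.U)
    (hd : MDifferentiableWithinAt 𝓘(ℝ, ℝ) (whitneyModel (Coord m k)) w J t) :
    (mfderivWithin 𝓘(ℝ, ℝ) (whitneyModel (Coord m k)) w J t (1 : ℝ)) ∈
      tangentVectors (whitneyModel (Coord m k)) (W₀ M) (w t) := by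
  rw [C.mem_tangentVectors_iff (hw t ht).1 (hw t ht).2]
  have hK := C.hasDerivWithinAt_whitneyCoords (hw t ht).2 hd
  set ξ := dCoords C.e (w t) (mfderivWithin 𝓘(ℝ, ℝ) (whitneyModel (Coord m k)) w J t (1 : ℝ))
  have hz := ((mem_W₀_iff (hw t ht).2).1 (hw t ht).1).1
  have hv : HasDerivWithinAt (fun s => (whitneyCoords C.e (w s)).2.2) ξ.2.2 J t := hK.snd.snd
  have h1 : HasDerivWithinAt (fun s => C.coords (w s)) (ξ.1, freeL ξ.2.2) J t :=
    hK.fst.prodMk (freeL.hasFDerivAt.comp_hasDerivWithinAt t hv)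
  have h2 : HasDerivWithinAt (fun s => boundL (whitneyCoords C.e (w s)).2.2) (boundL ξ.2.2) J t :=
    boundL.hasFDerivAt.comp_hasDerivWithinAt t hv
  have h3 := ((C.contDiffAt_Ψ hz).differentiableAt (by simp)).hasFDerivAt.comp_hasDerivWithinAt t h1
  refine hJ.eq_deriv _ h2 (h3.congr (fun s hs => ?_) ?_)
  · exact ((mem_W₀_iff (hw s hs).2).1 (hw s hs).1).2
  · exact ((mem_W₀_iff (hw t ht).2).1 (hw t ht).1).2

/-- Tangency of the velocity is automatic for a curve in W₀; the rest is `solvesAt_iff` with the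
covector equation for ṗ written in components. -/
theorem solvesAt_velocity_iff (hL : ContMDiff (𝓘(ℝ, Coord m k)).tangent 𝓘(ℝ, ℝ) ∞ L)
    (hJ : UniqueDiffWithinAt ℝ J t) (ht : t ∈ J)
    (hw : ∀ t ∈ J, w t ∈ W₀ M ∧ pr₂ (w t) ∈ C.U)
    (hd : MDifferentiableWithinAt 𝓘(ℝ, ℝ) (whitneyModel (Coord m k)) w J t) :
    SolvesAt L M (w t) (mfderivWithin 𝓘(ℝ, ℝ) (whitneyModel (Coord m k)) w J t (1 : ℝ)) ↔
      C.MomentumEquations L (w t) ∧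
      vel C.e (pr₂ (w t)) = derivWithin (fun s => C.e (w s).proj) J t ∧
      ∀ A, derivWithin (fun s => mom C.e (w s) A) J t = dq (C.restrictedL L) A (C.coords (w t)) -
        ∑ α, mom C.e (w t) (Fin.castAdd k α) * dq (fun z => C.Ψ z α) A (C.coords (w t)) := by
  have hz := ((mem_W₀_iff (hw t ht).2).1 (hw t ht).1).1
  rw [C.solvesAt_iff hL (hw t ht).1 (hw t ht).2,
    and_iff_right (C.velocity_mem_tangentVectors hJ ht hw hd)]
  have hK := C.hasDerivWithinAt_whitneyCoords (hw t ht).2 hd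
  set ξ := dCoords C.e (w t) (mfderivWithin 𝓘(ℝ, ℝ) (whitneyModel (Coord m k)) w J t (1 : ℝ))
  have hx : HasDerivWithinAt (fun s => C.e (w s).proj) ξ.1 J t := hK.fst
  have hp : HasDerivWithinAt (fun s => (whitneyCoords C.e (w s)).2.1) ξ.2.1 J t := hK.snd.fst
  have hpA : ∀ A, HasDerivWithinAt (fun s => mom C.e (w s) A)
      (ξ.2.1 (EuclideanSpace.single A 1)) J t := fun A =>
    (ContinuousLinearMap.apply ℝ ℝ (EuclideanSpace.single A (1 : ℝ))).hasFDerivAt.comp_hasDerivWithinAt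
      t hp
  rw [hx.derivWithin hJ]
  refine and_congr_right fun _ => and_congr eq_comm ?_
  have hA : ∀ A, fderiv ℝ (C.restrictedL L) (C.coords (w t)) (EuclideanSpace.single A 1, 0) -
      (whitneyCoords C.e (w t)).2.1 (glue (fderiv ℝ C.Ψ (C.coords (w t))
        (EuclideanSpace.single A 1, 0)) 0) = dq (C.restrictedL L) A (C.coords (w t)) -
      ∑ α, mom C.e (w t) (Fin.castAdd k α) * dq (fun z => C.Ψ z α) A (C.coords (w t)) := by
    intro A
    have hΨ : ∀ α, dq (fun z => C.Ψ z α) A (C.coords (w t)) =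
        fderiv ℝ C.Ψ (C.coords (w t)) (EuclideanSpace.single A 1, 0) α := by
      intro α
      rw [dq, fderiv_apply ((C.contDiffAt_Ψ hz).differentiableAt (by simp))]
      rfl
    rw [clm_apply_glue]
    simp only [hΨ]
    simp
    rfl
  constructor
  · intro h A
    rw [(hpA A).derivWithin hJ, h, hA]
  · intro h a
    -- A covector is determined by its components, so the equations for all ṗ_A recover the equation
    -- tested on every vector.
    have hlin : ξ.2.1 = (fderiv ℝ (C.restrictedL L) (C.coords (w t))).comp
        (ContinuousLinearMap.inl ℝ _ _) - (whitneyCoords C.e (w t)).2.1.comp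
        (glueL.comp (((fderiv ℝ C.Ψ (C.coords (w t))).comp
          (ContinuousLinearMap.inl ℝ _ _)).prod 0)) := by
      rw [clm_eq_sum ξ.2.1]
      conv_rhs => rw [clm_eq_sum (_ - _)]
      refine Finset.sum_congr rfl fun A _ => ?_
      rw [← (hpA A).derivWithin hJ, h, ← hA]
      rfl
    rw [hlin]
    rfl

end ConstraintChart

theorem natAdd_ne_castAdd {m k : ℕ} (a : Fin k) (α : Fin m) :
    Fin.natAdd m a ≠ Fin.castAdd k α := by
  intro h
  have := congrArg Fin.val h
  simp only [Fin.val_natAdd, Fin.val_castAdd] at this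
  omega

/-! ### Integral curves and the vakonomic equations -/

namespace ConstraintChart

variable {m k : ℕ} {Q : Type*} [TopologicalSpace Q] [ChartedSpace (Coord m k) Q]
  [IsManifold 𝓘(ℝ, Coord m k) ∞ Q]
  {M : Set (TangentBundle 𝓘(ℝ, Coord m k) Q)} (C : ConstraintChart M)
  {L : TangentBundle 𝓘(ℝ, Coord m k) Q → ℝ} {w : ℝ → WhitneySum (Coord m k) Q} {J : Set ℝ} {t : ℝ}

/-- Derivatives within `J` at points of `J` see only values on `J`. This is needed because the base
curve of a lift agrees with the given curve on `J` only. -/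
theorem vakonomicEquations_congr {x x' : ℝ → Coord m k} {μ μ' : ℝ → Fin m → ℝ}
    (hx : EqOn x x' J) (hμ : EqOn μ μ' J) (h : C.VakonomicEquations L J x μ) :
    C.VakonomicEquations L J x' μ' := by
  have hv : EqOn (derivWithin x J) (derivWithin x' J) J := fun t ht =>
    derivWithin_congr hx (hx ht)
  have hz : EqOn (fun t => (x t, free (derivWithin x J t)))
      (fun t => (x' t, free (derivWithin x' J t))) J := fun t ht => by
    simp only [hx ht, hv ht]
  have hg : ∀ g : Coord m k × (Fin k → ℝ) → ℝ, ∀ t ∈ J,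
      derivWithin (fun s => g (x s, free (derivWithin x J s))) J t =
      derivWithin (fun s => g (x' s, free (derivWithin x' J s))) J t := fun g t ht =>
    derivWithin_congr (fun s hs => congrArg g (hz hs)) (congrArg g (hz ht))
  have hμ' : ∀ α, ∀ t ∈ J, derivWithin (fun s => μ s α) J t = derivWithin (fun s => μ' s α) J t :=
    fun α t ht => derivWithin_congr (fun s hs => congrFun (hμ hs) α) (congrFun (hμ ht) α)
  intro t ht
  obtain ⟨h1, h2, h3, h4, h5, h6, h7⟩ := h t ht
  have hzt := hz ht
  simp only at hzt h4 h5 h6 h7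
  simp only [hg _ t ht, hμ' _ t ht, hμ ht, hzt] at h4 h5 h6 h7
  rw [hv ht] at h7
  exact ⟨h1.congr hx.symm (hx ht).symm, h2.congr hv.symm (hv ht).symm,
    h3.congr hμ.symm (hμ ht).symm, h4, h5, h6, h7⟩

/-- Along a differentiable curve in `W₁` whose velocity part is the velocity of its base curve, the
equations for `ṗ_A` are the vakonomic equations. -/
theorem vakonomicEquations_iff (hL : ContMDiff (𝓘(ℝ, Coord m k)).tangent 𝓘(ℝ, ℝ) ∞ L)
    (hJ : UniqueDiffOn ℝ J) (hw : ∀ t ∈ J, w t ∈ W₀ M ∧ pr₂ (w t) ∈ C.U)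
    (hd : ∀ t ∈ J, MDifferentiableWithinAt 𝓘(ℝ, ℝ) (whitneyModel (Coord m k)) w J t)
    (hp : ∀ t ∈ J, C.MomentumEquations L (w t))
    (hv : ∀ t ∈ J, vel C.e (pr₂ (w t)) = derivWithin (fun s => C.e (w s).proj) J t) :
    C.VakonomicEquations L J (fun t => C.e (w t).proj)
        (fun t α => mom C.e (w t) (Fin.castAdd k α)) ↔
      ∀ t ∈ J, ∀ A, derivWithin (fun s => mom C.e (w s) A) J t =
        dq (C.restrictedL L) A (C.coords (w t)) -
        ∑ α, mom C.e (w t) (Fin.castAdd k α) * dq (fun z => C.Ψ z α) A (C.coords (w t)) := by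
  -- The vakonomic equations are evaluated at (q, free part of the derivative of q), the momentum
  -- equations at (q, free part of v); `hv` identifies the two on `J`.
  have hzeq : EqOn (fun t => (C.e (w t).proj,
      free (derivWithin (fun s => C.e (w s).proj) J t))) (fun t => C.coords (w t)) J :=
    fun t ht => by simp only [coords, hv t ht]
  refine forall₂_congr fun t ht => ?_
  have hz := (mem_W₀_iff (hw t ht).2).1 (hw t ht).1
  have hK := C.hasDerivWithinAt_whitneyCoords (hw t ht).2 (hd t ht)
  set ξ := dCoords C.e (w t) (mfderivWithin 𝓘(ℝ, ℝ) (whitneyModel (Coord m k)) w J t (1 : ℝ))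
  have hx : HasDerivWithinAt (fun s => C.e (w s).proj) ξ.1 J t := hK.fst
  have hV : HasDerivWithinAt (fun s => vel C.e (pr₂ (w s))) ξ.2.2 J t := hK.snd.snd
  have hP : HasDerivWithinAt (fun s => (whitneyCoords C.e (w s)).2.1) ξ.2.1 J t := hK.snd.fst
  have hpA : ∀ A, DifferentiableWithinAt ℝ (fun s => mom C.e (w s) A) J t := fun A =>
    ((ContinuousLinearMap.apply ℝ ℝ
      (EuclideanSpace.single A (1 : ℝ))).hasFDerivAt.comp_hasDerivWithinAt
        t hP).differentiableWithinAt
  have hcoords : DifferentiableWithinAt ℝ (fun s => C.coords (w s)) J t :=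
    (hx.prodMk (freeL.hasFDerivAt.comp_hasDerivWithinAt t hV)).differentiableWithinAt
  have hdd : ∀ f : Coord m k × (Fin k → ℝ) → ℝ, ContDiffAt ℝ ∞ f (C.coords (w t)) → ∀ a,
      DifferentiableWithinAt ℝ (fun s => dqdot f a (C.coords (w s))) J t := fun f hf a =>
    DifferentiableAt.comp_differentiableWithinAt (g := dqdot f a) t (differentiableAt_dqdot hf a)
      hcoords
  have hg : ∀ (f : Coord m k × (Fin k → ℝ) → ℝ) a,
      derivWithin (fun s => dqdot f a (C.e (w s).proj,
        free (derivWithin (fun s => C.e (w s).proj) J s))) J t =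
      derivWithin (fun s => dqdot f a (C.coords (w s))) J t := fun f a =>
    derivWithin_congr (fun s hs => congrArg _ (hzeq hs)) (congrArg _ (hzeq ht))
  -- The time derivative of the momentum equation, by the product rule.
  have hmom : ∀ a, derivWithin (fun s => mom C.e (w s) (Fin.natAdd m a)) J t =
      derivWithin (fun s => dqdot (C.restrictedL L) a (C.coords (w s))) J t -
      ∑ α, (derivWithin (fun s => mom C.e (w s) (Fin.castAdd k α)) J t *
          dqdot (fun z => C.Ψ z α) a (C.coords (w t)) +
        mom C.e (w t) (Fin.castAdd k α) *
          derivWithin (fun s => dqdot (fun z => C.Ψ z α) a (C.coords (w s))) J t) := by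
    intro a
    rw [derivWithin_congr (fun s hs => hp s hs a) (hp t ht a)]
    have h1 := (hdd _ (C.contDiffAt_restrictedL hL hz.1) a).hasDerivWithinAt
    have h2 : ∀ α ∈ Finset.univ, HasDerivWithinAt (fun s => mom C.e (w s) (Fin.castAdd k α) *
        dqdot (fun z => C.Ψ z α) a (C.coords (w s))) _ J t := fun α _ =>
      (hpA (Fin.castAdd k α)).hasDerivWithinAt.mul
        (hdd _ (C.contDiffAt_Ψ_apply hz.1 α) a).hasDerivWithinAt
    exact (h1.sub (HasDerivWithinAt.fun_sum h2)).derivWithin (hJ t ht)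
  have hzt := hzeq ht
  simp only at hzt
  simp only [hg, hzt]
  rw [Fin.forall_fin_add]
  -- After substituting `hmom`, the equation for ṗ_a and the first vakonomic equation differ only by
  -- a rearrangement of terms.
  have hfree : ∀ a, (derivWithin (fun s => dqdot (C.restrictedL L) a (C.coords (w s))) J t -
        dq (C.restrictedL L) (Fin.natAdd m a) (C.coords (w t)) =
      ∑ α, (mom C.e (w t) (Fin.castAdd k α) *
          (derivWithin (fun s => dqdot (fun z => C.Ψ z α) a (C.coords (w s))) J t -
            dq (fun z => C.Ψ z α) (Fin.natAdd m a) (C.coords (w t))) +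
        derivWithin (fun s => mom C.e (w s) (Fin.castAdd k α)) J t *
          dqdot (fun z => C.Ψ z α) a (C.coords (w t)))) ↔
      derivWithin (fun s => mom C.e (w s) (Fin.natAdd m a)) J t =
        dq (C.restrictedL L) (Fin.natAdd m a) (C.coords (w t)) -
        ∑ α, mom C.e (w t) (Fin.castAdd k α) *
          dq (fun z => C.Ψ z α) (Fin.natAdd m a) (C.coords (w t)) := by
    intro a
    rw [hmom]
    simp only [mul_sub, Finset.sum_add_distrib, Finset.sum_sub_distrib]
    constructor <;> intro h <;> linarith
  constructor
  · rintro ⟨-, -, -, -, h5, h6, -⟩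
    exact ⟨h6, fun a => (hfree a).1 (h5 a)⟩
  · rintro ⟨h6, h5⟩
    refine ⟨hx.differentiableWithinAt, hV.differentiableWithinAt.congr (fun s hs => (hv s hs).symm)
      (hv t ht).symm, differentiableWithinAt_pi.2 fun α => hpA _, hz.1,
      fun a => (hfree a).2 (h5 a), h6, fun α => ?_⟩
    rw [← hv t ht, ← hz.2]
    rfl

/-- A curve in `W₀` over a solution of the vakonomic equations is differentiable. -/
theorem mdifferentiableWithinAt_of_vakonomicEquations
    (hL : ContMDiff (𝓘(ℝ, Coord m k)).tangent 𝓘(ℝ, ℝ) ∞ L)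
    (hJ : UniqueDiffOn ℝ J) (hw : ∀ t ∈ J, w t ∈ W₀ M ∧ pr₂ (w t) ∈ C.U)
    (hp : ∀ t ∈ J, C.MomentumEquations L (w t))
    (hv : ∀ t ∈ J, pr₂ (w t) = velocity 𝓘(ℝ, Coord m k) (fun s => (w s).proj) J t)
    (h : C.VakonomicEquations L J (fun t => C.e (w t).proj)
        (fun t α => mom C.e (w t) (Fin.castAdd k α))) :
    ∀ t ∈ J, MDifferentiableWithinAt 𝓘(ℝ, ℝ) (𝓘(ℝ, Coord m k)) (fun s => (w s).proj) J t ∧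
      MDifferentiableWithinAt 𝓘(ℝ, ℝ) (whitneyModel (Coord m k)) w J t := by
  have hsrc : ∀ t ∈ J, (w t).proj ∈ C.e.source := fun t ht => proj_mem (hw t ht).2
  have hc : ∀ t ∈ J, MDifferentiableWithinAt 𝓘(ℝ, ℝ) (𝓘(ℝ, Coord m k)) (fun s => (w s).proj) J t :=
    fun t ht => mdifferentiableWithinAt_of_chart C.e_mem ht hsrc (h t ht).1
  have hvel : ∀ t ∈ J, vel C.e (pr₂ (w t)) = derivWithin (fun s => C.e (w s).proj) J t :=
    fun t ht => (eq_velocity_iff C.e_mem (hJ t ht) (hc t ht) (hsrc t ht) rfl).1 (hv t ht)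
  intro t ht
  refine ⟨hc t ht, ?_⟩
  obtain ⟨h1, h2, h3, -⟩ := h t ht
  have hz := (mem_W₀_iff (hw t ht).2).1 (hw t ht).1
  have hV : DifferentiableWithinAt ℝ (fun s => vel C.e (pr₂ (w s))) J t :=
    h2.congr hvel (hvel t ht)
  have hcoords : DifferentiableWithinAt ℝ (fun s => C.coords (w s)) J t :=
    h1.prodMk (freeL.differentiableAt.comp_differentiableWithinAt t hV)
  have hdd : ∀ f : Coord m k × (Fin k → ℝ) → ℝ, ContDiffAt ℝ ∞ f (C.coords (w t)) → ∀ a,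
      DifferentiableWithinAt ℝ (fun s => dqdot f a (C.coords (w s))) J t := fun f hf a =>
    DifferentiableAt.comp_differentiableWithinAt (g := dqdot f a) t (differentiableAt_dqdot hf a)
      hcoords
  have hμ : ∀ α, DifferentiableWithinAt ℝ (fun s => mom C.e (w s) (Fin.castAdd k α)) J t :=
    differentiableWithinAt_pi.1 h3
  have hA : ∀ A, DifferentiableWithinAt ℝ (fun s => mom C.e (w s) A) J t := by
    rw [Fin.forall_fin_add]
    refine ⟨hμ, fun a => ?_⟩
    -- Differentiability of p_a is not assumed: the momentum equations express p_a through μ and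
    -- smooth functions of (q, q̇^a).
    refine DifferentiableWithinAt.congr ?_ (fun s hs => hp s hs a) (hp t ht a)
    exact (hdd _ (C.contDiffAt_restrictedL hL hz.1) a).sub (DifferentiableWithinAt.fun_sum
      fun α _ => (hμ α).mul (hdd _ (C.contDiffAt_Ψ_apply hz.1 α) a))
  have hP : DifferentiableWithinAt ℝ (fun s => (whitneyCoords C.e (w s)).2.1) J t := by
    refine DifferentiableWithinAt.congr (f := fun s => ∑ A, mom C.e (w s) A •
      (EuclideanSpace.proj A : Coord m k →L[ℝ] ℝ)) ?_ (fun s _ => clm_eq_sum _) (clm_eq_sum _)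
    exact DifferentiableWithinAt.fun_sum fun A _ => (hA A).smul_const _
  have hlift := (C.contDiffAt_lift_coords hz.1 (whitneyCoords C.e (w t)).2.1).mdifferentiableAt
    (by simp)
  -- On `J` the curve is the smooth map `C.lift` applied to its differentiable coordinates.
  refine (MDifferentiableAt.comp_mdifferentiableWithinAt
    (g := fun y : (Coord m k × (Fin k → ℝ)) × (Coord m k →L[ℝ] ℝ) => C.lift y.1 y.2)
    (f := fun s => (C.coords (w s), (whitneyCoords C.e (w s)).2.1)) t hlift
    (hcoords.prodMk hP).mdifferentiableWithinAt).congr (fun s hs => ?_) ?_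
  · exact (C.lift_coords (hw s hs).1 (hw s hs).2).symm
  · exact (C.lift_coords (hw t ht).1 (hw t ht).2).symm

/-- Integral curves are the lifts to `W₁` of the solutions of the vakonomic equations. -/
theorem isSolutionCurve_iff (hL : ContMDiff (𝓘(ℝ, Coord m k)).tangent 𝓘(ℝ, ℝ) ∞ L)
    (hJ : UniqueDiffOn ℝ J) (hw : ∀ t ∈ J, w t ∈ W₀ M ∧ pr₂ (w t) ∈ C.U) :
    IsSolutionCurve L M J w ↔
      (∀ t ∈ J, pr₂ (w t) = velocity 𝓘(ℝ, Coord m k) (fun s => (w s).proj) J t) ∧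
      (∀ t ∈ J, C.MomentumEquations L (w t)) ∧
      C.VakonomicEquations L J (fun t => C.e (w t).proj)
        (fun t α => mom C.e (w t) (Fin.castAdd k α)) := by
  constructor
  · intro h
    have hs := fun t ht => (C.solvesAt_velocity_iff hL (hJ t ht) ht hw (h t ht).2.1).1 (h t ht).2.2
    refine ⟨fun t ht => ?_, fun t ht => (hs t ht).1, ?_⟩
    · have hc : MDifferentiableWithinAt 𝓘(ℝ, ℝ) (𝓘(ℝ, Coord m k)) (fun s => (w s).proj) J t :=
        ((contMDiffAt_proj (n := 1) _).mdifferentiableAt (by simp)).comp_mdifferentiableWithinAt t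
          (h t ht).2.1
      exact (eq_velocity_iff C.e_mem (hJ t ht) hc (proj_mem (hw t ht).2) rfl).2 (hs t ht).2.1
    · exact (C.vakonomicEquations_iff hL hJ hw (fun t ht => (h t ht).2.1) (fun t ht => (hs t ht).1)
        (fun t ht => (hs t ht).2.1)).2 fun t ht => (hs t ht).2.2
  · rintro ⟨hv, hp, h⟩
    have hd := C.mdifferentiableWithinAt_of_vakonomicEquations hL hJ hw hp hv h
    have hvel : ∀ t ∈ J, vel C.e (pr₂ (w t)) = derivWithin (fun s => C.e (w s).proj) J t :=
      fun t ht => (eq_velocity_iff C.e_mem (hJ t ht) (hd t ht).1 (proj_mem (hw t ht).2) rfl).1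
        (hv t ht)
    intro t ht
    refine ⟨(hw t ht).1, (hd t ht).2, (C.solvesAt_velocity_iff hL (hJ t ht) ht hw (hd t ht).2).2
      ⟨hp t ht, hvel t ht, ?_⟩⟩
    exact (C.vakonomicEquations_iff hL hJ hw (fun t ht => (hd t ht).2) hp hvel).1 h t ht

/-- Induced coordinates separate points over the chart, and the p_A determine the covector. -/
theorem eq_of_coords_eq {w w' : WhitneySum (Coord m k) Q} (hU : pr₂ w ∈ C.U)
    (h : pr₂ w' = pr₂ w) (hA : ∀ A, mom C.e w' A = mom C.e w A) : w' = w := by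
  have hproj : w'.proj = w.proj := congrArg (fun v => v.proj) h
  have hsrc := proj_mem hU
  rw [← ofWhitneyCoords_whitneyCoords C.e_mem hsrc,
    ← ofWhitneyCoords_whitneyCoords C.e_mem (w := w') (by rw [hproj]; exact hsrc)]
  congr 1
  refine Prod.ext (congrArg C.e hproj) (Prod.ext ?_ ?_)
  · rw [clm_eq_sum (whitneyCoords C.e w').2.1, clm_eq_sum (whitneyCoords C.e w).2.1]
    exact Finset.sum_congr rfl fun A _ => congrArg (· • _) (hA A)
  · exact congrArg (fun v => (tangentCoords C.e v).2) h

/-- Every solution of the vakonomic equations is the projection of exactly one integral curve. -/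
theorem exists_unique_isSolutionCurve (hL : ContMDiff (𝓘(ℝ, Coord m k)).tangent 𝓘(ℝ, ℝ) ∞ L)
    (hJ : UniqueDiffOn ℝ J) {c : ℝ → Q} {μ : ℝ → Fin m → ℝ} (hc : ∀ t ∈ J, c t ∈ C.e.source)
    (h : C.VakonomicEquations L J (fun t => C.e (c t)) μ) :
    ∃ w : ℝ → WhitneySum (Coord m k) Q,
      (IsSolutionCurve L M J w ∧ ∀ t ∈ J,
        pr₂ (w t) = velocity 𝓘(ℝ, Coord m k) c J t ∧
        ∀ α, mom C.e (w t) (Fin.castAdd k α) = μ t α) ∧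
      ∀ w' : ℝ → WhitneySum (Coord m k) Q,
        (IsSolutionCurve L M J w' ∧ ∀ t ∈ J,
          pr₂ (w' t) = velocity 𝓘(ℝ, Coord m k) c J t ∧
          ∀ α, mom C.e (w' t) (Fin.castAdd k α) = μ t α) →
        ∀ t ∈ J, w' t = w t := by
  set z : ℝ → Coord m k × (Fin k → ℝ) := fun t =>
    (C.e (c t), free (derivWithin (fun s => C.e (c s)) J t)) with hzdef
  have hz : ∀ t ∈ J, z t ∈ C.O := fun t ht => (h t ht).2.2.2.1
  have hΨ : ∀ t ∈ J, glue (C.Ψ (z t)) (z t).2 = derivWithin (fun s => C.e (c s)) J t :=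
    fun t ht => (eq_glue_iff.2 ⟨funext (h t ht).2.2.2.2.2.2, rfl⟩).symm
  -- The only possible momentum: p_α = μ_α is prescribed, and p_a is read off the momentum
  -- equations.
  set p : ℝ → Coord m k →L[ℝ] ℝ := fun t =>
    ∑ α, μ t α • EuclideanSpace.proj (Fin.castAdd k α) +
    ∑ a, (dqdot (C.restrictedL L) a (z t) - ∑ α, μ t α * dqdot (fun z => C.Ψ z α) a (z t)) •
      EuclideanSpace.proj (Fin.natAdd m a) with hpdef
  set w : ℝ → WhitneySum (Coord m k) Q := fun t => C.lift (z t) (p t) with hwdef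
  have hK : ∀ t ∈ J, whitneyCoords C.e (w t) = ((z t).1, p t, glue (C.Ψ (z t)) (z t).2) :=
    fun t ht => C.whitneyCoords_lift (hz t ht) (p t)
  have hcoords : ∀ t ∈ J, C.coords (w t) = z t := fun t ht => by
    rw [coords_eq, hK t ht]
    exact Prod.ext rfl (free_glue _ _)
  have hw : ∀ t ∈ J, w t ∈ W₀ M ∧ pr₂ (w t) ∈ C.U := fun t ht =>
    ⟨C.tangentOf_mem (hz t ht), (C.graph_mem _ (hz t ht)).2⟩
  have hmom : ∀ t ∈ J, ∀ A, mom C.e (w t) A = p t (EuclideanSpace.single A 1) := fun t ht A =>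
    congrArg (fun y : Coord m k × (Coord m k →L[ℝ] ℝ) × Coord m k =>
      y.2.1 (EuclideanSpace.single A 1)) (hK t ht)
  have hμ : ∀ t ∈ J, ∀ α, mom C.e (w t) (Fin.castAdd k α) = μ t α := fun t ht α => by
    rw [hmom t ht, hpdef]
    simp [natAdd_ne_castAdd]
  have hp : ∀ t ∈ J, C.MomentumEquations L (w t) := fun t ht a => by
    rw [hcoords t ht]
    simp only [hμ t ht]
    rw [hmom t ht, hpdef]
    simp [(natAdd_ne_castAdd _ _).symm]
  have hproj : EqOn (fun t => (w t).proj) c J := fun t ht => C.e.left_inv (hc t ht)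
  have hcd : ∀ t ∈ J, MDifferentiableWithinAt 𝓘(ℝ, ℝ) (𝓘(ℝ, Coord m k)) c J t := fun t ht =>
    mdifferentiableWithinAt_of_chart C.e_mem ht hc (h t ht).1
  have hvel : ∀ t ∈ J, vel C.e (pr₂ (w t)) = derivWithin (fun s => C.e (c s)) J t := fun t ht => by
    rw [← hΨ t ht]
    exact congrArg (fun y : Coord m k × (Coord m k →L[ℝ] ℝ) × Coord m k => y.2.2) (hK t ht)
  have hvc : ∀ t ∈ J, pr₂ (w t) = velocity 𝓘(ℝ, Coord m k) c J t := fun t ht =>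
    (eq_velocity_iff C.e_mem (hJ t ht) (hcd t ht) (hc t ht) (hproj ht)).2 (hvel t ht)
  have hsol : IsSolutionCurve L M J w := by
    refine (C.isSolutionCurve_iff hL hJ hw).2 ⟨fun t ht => ?_, hp, ?_⟩
    · refine (eq_velocity_iff C.e_mem (hJ t ht) ((hcd t ht).congr hproj (hproj ht))
        (proj_mem (hw t ht).2) rfl).2 ((hvel t ht).trans ?_)
      exact (derivWithin_congr (fun s hs => congrArg C.e (hproj hs)) (congrArg C.e (hproj ht))).symm
    · exact C.vakonomicEquations_congr (fun s hs => (congrArg C.e (hproj hs)).symm)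
        (fun s hs => funext fun α => (hμ s hs α).symm) h
  refine ⟨w, ⟨hsol, fun t ht => ⟨hvc t ht, hμ t ht⟩⟩, fun w' ⟨hw', hw''⟩ t ht => ?_⟩
  have hpr : ∀ t ∈ J, pr₂ (w' t) = pr₂ (w t) := fun t ht => (hw'' t ht).1.trans (hvc t ht).symm
  have hU' : ∀ t ∈ J, w' t ∈ W₀ M ∧ pr₂ (w' t) ∈ C.U := fun t ht =>
    ⟨(hw' t ht).1, by rw [hpr t ht]; exact (hw t ht).2⟩
  -- Any competing integral curve satisfies the momentum equations as well, which fixes its p_a.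
  have hp' := ((C.isSolutionCurve_iff hL hJ hU').1 hw').2.1 t ht
  refine C.eq_of_coords_eq (hw t ht).2 (hpr t ht) ((Fin.forall_fin_add _).2 ⟨fun α => ?_, fun a => ?_⟩)
  · rw [(hw'' t ht).2, hμ t ht]
  · have hco : C.coords (w' t) = C.coords (w t) :=
      congrArg (fun v => ((tangentCoords C.e v).1, free (tangentCoords C.e v).2)) (hpr t ht)
    rw [hp' a, hp t ht a, hco]
    simp only [(hw'' t ht).2, hμ t ht]

end ConstraintChart

/-! ### Solving the constraints: inverse and implicit functions -/

/-- The inverse function theorem, with an inverse that is smooth on its whole domain. -/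
theorem exists_openPartialHomeomorph_of_contDiffOn {E F : Type*} [NormedAddCommGroup E]
    [NormedSpace ℝ E] [CompleteSpace E] [NormedAddCommGroup F] [NormedSpace ℝ F] {G : E → F}
    {D : Set E} (hD : IsOpen D) (hG : ContDiffOn ℝ ∞ G D) {y : E} (hy : y ∈ D)
    {A : E ≃L[ℝ] F} (hA : fderiv ℝ G y = A) :
    ∃ R : OpenPartialHomeomorph E F, (R : E → F) = G ∧ y ∈ R.source ∧ R.source ⊆ D ∧
      ContDiffOn ℝ ∞ R.symm R.target := by
  have hGy : ∀ z ∈ D, ContDiffAt ℝ ∞ G z := fun z hz => hG.contDiffAt (hD.mem_nhds hz)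
  have hfd : ∀ z ∈ D, HasFDerivAt G (fderiv ℝ G z) z := fun z hz =>
    ((hGy z hz).differentiableAt (by simp)).hasFDerivAt
  -- Invertibility of the derivative is an open condition. Restricting to `D'` makes the inverse
  -- smooth at every point of its domain and not only at the image of `y`.
  set D' : Set E := D ∩ fderiv ℝ G ⁻¹' range ((↑) : (E ≃L[ℝ] F) → E →L[ℝ] F) with hD'
  have hD'o : IsOpen D' :=
    (hG.continuousOn_fderiv_of_isOpen hD (by simp)).isOpen_inter_preimage hD
      ContinuousLinearEquiv.isOpen
  have hA' : HasFDerivAt G (A : E →L[ℝ] F) y := hA ▸ hfd y hy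
  set R := ((hGy y hy).toOpenPartialHomeomorph G hA' (by simp)).restrOpen D' hD'o with hR
  have hsrc : R.source ⊆ D' := by
    rw [hR, OpenPartialHomeomorph.restrOpen_source]
    exact inter_subset_right
  refine ⟨R, rfl, ?_, hsrc.trans inter_subset_left, fun z hz => ?_⟩
  · rw [hR, OpenPartialHomeomorph.restrOpen_source]
    exact ⟨(hGy y hy).mem_toOpenPartialHomeomorph_source hA' (by simp), hy, A, hA.symm⟩
  · obtain ⟨h1, B, hB⟩ := hsrc (R.map_target hz)
    have h2 : HasFDerivAt R (B : E →L[ℝ] F) (R.symm z) := by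
      rw [hB]
      exact hfd _ h1
    exact (R.contDiffAt_symm hz h2 (hGy _ h1)).contDiffWithinAt

section LinearAlgebra

variable {m k : ℕ}

/-- A surjection onto `ℝᵐ` is, up to a linear change of coordinates, the projection to the first
`m` components. -/
theorem exists_equiv_boundL_eq {T : Coord m k →L[ℝ] (Fin m → ℝ)} (hT : Function.Surjective T) :
    ∃ A : Coord m k ≃L[ℝ] Coord m k, ∀ u, boundL (A u) = T u := by
  obtain ⟨P, hP⟩ := (T.toLinearMap.ker).subtype.exists_leftInverse_of_injective
    (Submodule.ker_subtype _)
  have hdim : Module.finrank ℝ T.toLinearMap.ker = Module.finrank ℝ (Fin k → ℝ) := by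
    have h1 := T.toLinearMap.finrank_range_add_finrank_ker
    rw [LinearMap.range_eq_top.2 hT, finrank_top] at h1
    simp only [Module.finrank_fin_fun, finrank_euclideanSpace_fin] at h1 ⊢
    omega
  let φ : T.toLinearMap.ker ≃ₗ[ℝ] (Fin k → ℝ) := LinearEquiv.ofFinrankEq _ _ hdim
  -- `P` is a projection onto the kernel of T, so T u and P u together determine u.
  let g : Coord m k →ₗ[ℝ] Coord m k :=
    glueL.toLinearMap ∘ₗ T.toLinearMap.prod (φ.toLinearMap ∘ₗ P)
  have hg : ∀ u, g u = glue (T u) (φ (P u)) := fun u => rfl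
  have hinj : Function.Injective g := by
    rw [injective_iff_map_eq_zero]
    intro u hu
    rw [hg] at hu
    have h1 : T u = 0 := by rw [← boundL_glue (T u) (φ (P u)), hu, map_zero]
    have h2 : φ (P u) = 0 := by rw [← free_glue (T u) (φ (P u)), hu]; rfl
    have h3 : P u = ⟨u, h1⟩ := LinearMap.congr_fun hP ⟨u, h1⟩
    have h4 := (map_eq_zero_iff φ φ.injective).1 h2
    rw [h3] at h4
    exact congrArg Subtype.val h4
  refine ⟨(LinearEquiv.ofInjectiveEndo g hinj).toContinuousLinearEquiv, fun u => ?_⟩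
  exact boundL_glue _ _

end LinearAlgebra

section Charts

variable {m k : ℕ} {Q : Type*} [TopologicalSpace Q] [ChartedSpace (Coord m k) Q]
  [IsManifold 𝓘(ℝ, Coord m k) ∞ Q] {M : Set (TangentBundle 𝓘(ℝ, Coord m k) Q)}
  {e : OpenPartialHomeomorph Q (Coord m k)} {U : Set (TangentBundle 𝓘(ℝ, Coord m k) Q)}
  {Φ : TangentBundle 𝓘(ℝ, Coord m k) Q → (Fin m → ℝ)} {x : TangentBundle 𝓘(ℝ, Coord m k) Q}

/-- The implicit function theorem in the coordinates of a chart in which `∂Φ^β/∂q̇^A` is the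
matrix `(1 0)` at the given point. -/
theorem exists_constraintChart_of_fderiv (he : e ∈ IsManifold.maximalAtlas 𝓘(ℝ, Coord m k) ∞ Q)
    (hU : IsOpen U) (hΦ : ContMDiffOn (𝓘(ℝ, Coord m k)).tangent 𝓘(ℝ, Fin m → ℝ) ∞ Φ U)
    (hM : ∀ y ∈ U, y ∈ M ↔ Φ y = 0) (hx : x ∈ U) (hxe : x.proj ∈ e.source)
    (hT : ∀ u : Coord m k, fderiv ℝ (Φ ∘ ofTangentCoords e) (tangentCoords e x) (0, u) = boundL u) :
    ∃ C : ConstraintChart M, x ∈ C.U := by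
  set F := Φ ∘ ofTangentCoords e with hF
  set D : Set (Coord m k × Coord m k) :=
    (Prod.fst ⁻¹' e.target) ∩ ofTangentCoords e ⁻¹' U with hDdef
  have htgt : IsOpen (Prod.fst ⁻¹' e.target : Set (Coord m k × Coord m k)) :=
    e.open_target.preimage continuous_fst
  have hD : IsOpen D := ContinuousOn.isOpen_inter_preimage
    (fun y hy => (contMDiffAt_ofTangentCoords he hy).continuousAt.continuousWithinAt) htgt hU
  have hFs : ContDiffOn ℝ ∞ F D := fun y hy =>
    (((hΦ.contMDiffAt (hU.mem_nhds hy.2)).comp y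
      (contMDiffAt_ofTangentCoords he hy.1)).contDiffAt).contDiffWithinAt
  have hxD : tangentCoords e x ∈ D :=
    ⟨e.map_source hxe, by rw [mem_preimage, ofTangentCoords_tangentCoords he hxe]; exact hx⟩
  -- The bound velocities are replaced by the constraint values, so that M becomes the set where the
  -- bound components of `G` vanish.
  set G : Coord m k × Coord m k → Coord m k × Coord m k := fun y => (y.1, glue (F y) (free y.2))
    with hG
  have hGs : ContDiffOn ℝ ∞ G D :=
    contDiffOn_fst.prodMk (glueL.contDiff.comp_contDiffOn
      (hFs.prodMk (freeL.contDiff.comp_contDiffOn contDiffOn_snd)))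
  have hG' : ∀ u, fderiv ℝ G (tangentCoords e x) u =
      (u.1, glue (fderiv ℝ F (tangentCoords e x) u) (free u.2)) := by
    intro u
    have h1 := ((hFs.contDiffAt (hD.mem_nhds hxD)).differentiableAt (by simp)).hasFDerivAt
    have h2 : HasFDerivAt G _ (tangentCoords e x) := hasFDerivAt_fst.prodMk
      (glueL.hasFDerivAt.comp _ (h1.prodMk (freeL.hasFDerivAt.comp _ hasFDerivAt_snd)))
    rw [h2.fderiv]
    rfl
  -- A kernel vector has q-component 0, and on vectors (0, b) the derivative is the identity by
  -- `hT`.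
  have hinj : Function.Injective (fderiv ℝ G (tangentCoords e x)).toLinearMap := by
    rw [injective_iff_map_eq_zero]
    rintro ⟨a, b⟩ hab
    have h1 := (hG' (a, b)).symm.trans hab
    obtain rfl : a = 0 := congrArg Prod.fst h1
    have h2 : glue (fderiv ℝ F (tangentCoords e x) (0, b)) (free b) = 0 := congrArg Prod.snd h1
    rw [hT, glue_boundL_free] at h2
    rw [h2]
    rfl
  obtain ⟨R, hRG, hxR, hRD, hRs⟩ := exists_openPartialHomeomorph_of_contDiffOn hD hGs hxD
    (A := (LinearEquiv.ofInjectiveEndo _ hinj).toContinuousLinearEquiv)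
    (by ext u <;> rfl)
  have hsrcO : IsOpen {v : TangentBundle 𝓘(ℝ, Coord m k) Q | v.proj ∈ e.source} :=
    e.open_source.preimage (FiberBundle.continuous_proj _ _)
  -- The slice where the constraints vanish; the bound part of `R.symm` on it is Ψ.
  set j : Coord m k × (Fin k → ℝ) → Coord m k × Coord m k := fun z => (z.1, glueL (0, z.2)) with hj
  have hjs : ContDiff ℝ ∞ j := contDiff_fst.prodMk (glueL.contDiff.comp
    (contDiff_const.prodMk contDiff_snd))
  have hsymm : ∀ z, j z ∈ R.target → (R.symm (j z)).1 = z.1 ∧ free (R.symm (j z)).2 = z.2 ∧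
      F (R.symm (j z)) = 0 := by
    intro z hz
    have h1 : G (R.symm (j z)) = j z := by
      rw [← hRG]
      exact R.right_inv hz
    have h2 : glue (F (R.symm (j z))) (free (R.symm (j z)).2) = glue 0 z.2 := congrArg Prod.snd h1
    refine ⟨congrArg Prod.fst h1, ?_, ?_⟩
    · rw [← free_glue (F (R.symm (j z))) (free (R.symm (j z)).2), h2, free_glue]
    · rw [← boundL_glue (F (R.symm (j z))) (free (R.symm (j z)).2), h2, boundL_glue]
  have hpt : ∀ z, j z ∈ R.target →
      (z.1, glue (boundL (R.symm (j z)).2) z.2) = R.symm (j z) := by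
    intro z hz
    obtain ⟨h1, h2, -⟩ := hsymm z hz
    rw [← h1]
    conv_lhs => rw [← h2]
    rw [glue_boundL_free]
  let C : ConstraintChart M :=
    { e := e
      e_mem := he
      U := {v | v.proj ∈ e.source} ∩ tangentCoords e ⁻¹' R.source
      isOpen_U := ContinuousOn.isOpen_inter_preimage
        (fun v hv => (contMDiffAt_tangentCoords he hv).continuousAt.continuousWithinAt)
        hsrcO R.open_source
      U_subset := fun v hv => hv.1
      -- The full preimage of the target is admissible: `R.symm` sends each of its points to a point
      -- of M with coordinates in `R.source`.
      O := j ⁻¹' R.target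
      isOpen_O := R.open_target.preimage hjs.continuous
      Ψ := fun z => boundL (R.symm (j z)).2
      smooth_Ψ := boundL.contDiff.comp_contDiffOn (contDiff_snd.comp_contDiffOn
        (hRs.comp hjs.contDiffOn fun z hz => hz))
      mem_iff := by
        rintro v ⟨hv, hvR⟩
        have h1 : v ∈ M ↔ F (tangentCoords e v) = 0 := by
          have h := hM v (by
            have := (hRD hvR).2
            rwa [mem_preimage, ofTangentCoords_tangentCoords he hv] at this)
          rw [h, hF, Function.comp_apply, ofTangentCoords_tangentCoords he hv]
        rw [h1]
        constructor
        · intro h0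
          have h2 : R (tangentCoords e v) = j (e v.proj, free (vel e v)) := by
            rw [hRG, hG]
            simp only [h0]
            rfl
          refine ⟨by rw [mem_preimage, ← h2]; exact R.map_source hvR, fun α => ?_⟩
          rw [← h2, R.left_inv hvR]
          rfl
        · rintro ⟨h2, h3⟩
          have h4 : tangentCoords e v = R.symm (j (e v.proj, free (vel e v))) := by
            rw [← hpt _ h2]
            exact Prod.ext rfl (eq_glue_iff.2 ⟨funext h3, rfl⟩)
          rw [h4]
          exact (hsymm _ h2).2.2
      graph_mem := by
        intro z hz
        have h1 := R.map_target hz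
        have h2 : z.1 ∈ e.target := by
          rw [← (hsymm z hz).1]
          exact (hRD h1).1
        refine ⟨h2, e.map_target h2, ?_⟩
        have h3 := tangentCoords_ofTangentCoords he (y := (z.1, glue (boundL (R.symm (j z)).2) z.2))
          h2
        rw [mem_preimage]
        change tangentCoords e (ofTangentCoords e (z.1, glue (boundL (R.symm (j z)).2) z.2)) ∈ _
        rw [h3, hpt z hz]
        exact h1 }
  exact ⟨C, hxe, hxR⟩

end Charts

/-- A linear change of chart is its own derivative, so it acts in the same way on positions and on
velocities. -/
theorem ofTangentCoords_transHomeomorph {m k : ℕ} {Q : Type*} [TopologicalSpace Q]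
    [ChartedSpace (Coord m k) Q] {e : OpenPartialHomeomorph Q (Coord m k)}
    (he : e ∈ IsManifold.maximalAtlas 𝓘(ℝ, Coord m k) ∞ Q) (A : Coord m k ≃L[ℝ] Coord m k)
    {y : Coord m k × Coord m k} (hy : A.symm y.1 ∈ e.target) :
    ofTangentCoords (e.transHomeomorph A.toHomeomorph) y =
      ofTangentCoords e (A.symm y.1, A.symm y.2) := by
  have h := mfderiv_comp y.1 ((contMDiffAt_symm_of_mem_maximalAtlas he hy).mdifferentiableAt
    (by simp)) A.symm.toContinuousLinearMap.mdifferentiableAt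
  erw [ContinuousLinearEquiv.mfderiv_eq] at h
  exact congrArg (fun u => (⟨e.symm (A.symm y.1), u⟩ : TangentBundle 𝓘(ℝ, Coord m k) Q))
    (DFunLike.congr_fun h y.2)

/-! ### Admissibility and the existence of constraint charts -/

section Admissible

variable {m k : ℕ} {Q : Type*} [TopologicalSpace Q] [ChartedSpace (Coord m k) Q]
  [IsManifold 𝓘(ℝ, Coord m k) ∞ Q] {M : Set (TangentBundle 𝓘(ℝ, Coord m k) Q)}
  {e : OpenPartialHomeomorph Q (Coord m k)} {U : Set (TangentBundle 𝓘(ℝ, Coord m k) Q)}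
  {Φ : TangentBundle 𝓘(ℝ, Coord m k) Q → (Fin m → ℝ)} {x : TangentBundle 𝓘(ℝ, Coord m k) Q}

/-- The vertical endomorphism is `(δq, δv) ↦ (0, δq)` in the coordinates of a chart. -/
theorem mfderiv_tangentCoords_verticalEndo
    (he : e ∈ IsManifold.maximalAtlas 𝓘(ℝ, Coord m k) ∞ Q) (hxe : x.proj ∈ e.source)
    (ξ : TangentSpace (𝓘(ℝ, Coord m k)).tangent x) :
    mfderiv (𝓘(ℝ, Coord m k)).tangent 𝓘(ℝ, Coord m k × Coord m k) (tangentCoords e) x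
        (verticalEndo x ξ) =
      (0, (mfderiv (𝓘(ℝ, Coord m k)).tangent 𝓘(ℝ, Coord m k × Coord m k) (tangentCoords e) x
        ξ).1) := by
  have hτ : MDifferentiableAt (𝓘(ℝ, Coord m k)).tangent 𝓘(ℝ, Coord m k × Coord m k)
      (tangentCoords e) x := (contMDiffAt_tangentCoords he hxe).mdifferentiableAt (by simp)
  set D : Coord m k →L[ℝ] Coord m k := mfderiv 𝓘(ℝ, Coord m k) 𝓘(ℝ, Coord m k) e x.proj with hD
  have hι : MDifferentiableAt 𝓘(ℝ, Coord m k) (𝓘(ℝ, Coord m k)).tangent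
      (fun u : Coord m k => (⟨x.proj, u⟩ : TangentBundle 𝓘(ℝ, Coord m k) Q))
      (show Coord m k from x.snd) := by
    have h1 : (fun u : Coord m k => (⟨x.proj, u⟩ : TangentBundle 𝓘(ℝ, Coord m k) Q)) =
        ofTangentCoords e ∘ fun u => (e x.proj, D u) := by
      ext1 u
      exact (ofTangentCoords_tangentCoords he (v := ⟨x.proj, u⟩) hxe).symm
    rw [h1]
    have h2 : MDifferentiableAt 𝓘(ℝ, Coord m k × Coord m k) (𝓘(ℝ, Coord m k)).tangent
        (ofTangentCoords e) (e x.proj, D x.snd) :=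
      (contMDiffAt_ofTangentCoords he (y := (e x.proj, D x.snd))
        (e.map_source hxe)).mdifferentiableAt (by simp)
    have h3 : DifferentiableAt ℝ (fun u : Coord m k => (e x.proj, D u))
      (show Coord m k from x.snd) := by fun_prop
    exact h2.comp (show Coord m k from x.snd) h3.mdifferentiableAt
  have h1 : ∀ u : Coord m k,
      mfderiv (𝓘(ℝ, Coord m k)).tangent 𝓘(ℝ, Coord m k × Coord m k) (tangentCoords e) x
        (mfderiv 𝓘(ℝ, Coord m k) (𝓘(ℝ, Coord m k)).tangent
          (fun u : Coord m k => (⟨x.proj, u⟩ : TangentBundle 𝓘(ℝ, Coord m k) Q))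
          (show Coord m k from x.snd) u) = (0, D u) := by
    intro u
    have h2 := mfderiv_comp (show Coord m k from x.snd) hτ hι
    have h3 : HasFDerivAt (fun u : Coord m k => (e x.proj, D u))
        ((0 : Coord m k →L[ℝ] Coord m k).prod D) (show Coord m k from x.snd) :=
      (hasFDerivAt_const _ _).prodMk D.hasFDerivAt
    exact DFunLike.congr_fun (h2.symm.trans h3.hasMFDerivAt.mfderiv) u
  have h4 : D (mfderiv (𝓘(ℝ, Coord m k)).tangent 𝓘(ℝ, Coord m k)
      (fun y : TangentBundle 𝓘(ℝ, Coord m k) Q => y.proj) x ξ) =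
      (mfderiv (𝓘(ℝ, Coord m k)).tangent 𝓘(ℝ, Coord m k × Coord m k) (tangentCoords e) x ξ).1 := by
    have h5 := mfderiv_comp (I := (𝓘(ℝ, Coord m k)).tangent) (I' := 𝓘(ℝ, Coord m k)) x
      ((contMDiffAt_of_mem_maximalAtlas he hxe).mdifferentiableAt (by simp))
      ((contMDiffAt_proj (n := 1) _).mdifferentiableAt (by simp))
    have h6 := mfderiv_comp x
      (differentiableAt_fst (𝕜 := ℝ) (E := Coord m k) (F := Coord m k)).mdifferentiableAt hτ
    rw [mfderiv_eq_fderiv, fderiv_fst] at h6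
    exact DFunLike.congr_fun (h5.symm.trans h6) ξ
  rw [← h4]
  exact h1 _

/-- The differential of a function on `TQ` in the coordinates of a chart. -/
theorem mfderiv_eq_fderiv_tangentCoords
    (he : e ∈ IsManifold.maximalAtlas 𝓘(ℝ, Coord m k) ∞ Q) (hxe : x.proj ∈ e.source)
    (hΦ : ContMDiffAt (𝓘(ℝ, Coord m k)).tangent 𝓘(ℝ, Fin m → ℝ) ∞ Φ x)
    (ξ : TangentSpace (𝓘(ℝ, Coord m k)).tangent x) :
    mfderiv (𝓘(ℝ, Coord m k)).tangent 𝓘(ℝ, Fin m → ℝ) Φ x ξ =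
      fderiv ℝ (Φ ∘ ofTangentCoords e) (tangentCoords e x)
        (mfderiv (𝓘(ℝ, Coord m k)).tangent 𝓘(ℝ, Coord m k × Coord m k) (tangentCoords e) x ξ) := by
  have hτ : MDifferentiableAt (𝓘(ℝ, Coord m k)).tangent 𝓘(ℝ, Coord m k × Coord m k)
      (tangentCoords e) x := (contMDiffAt_tangentCoords he hxe).mdifferentiableAt (by simp)
  have hinv : ofTangentCoords e (tangentCoords e x) = x := ofTangentCoords_tangentCoords he hxe
  have hF : DifferentiableAt ℝ (Φ ∘ ofTangentCoords e) (tangentCoords e x) := by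
    have h1 : ContMDiffAt (𝓘(ℝ, Coord m k)).tangent 𝓘(ℝ, Fin m → ℝ) ∞ Φ
        (ofTangentCoords e (tangentCoords e x)) := by rw [hinv]; exact hΦ
    exact (h1.comp (tangentCoords e x) (contMDiffAt_ofTangentCoords he
      (e.map_source hxe))).contDiffAt.differentiableAt (by simp)
  have hev : (Φ ∘ ofTangentCoords e) ∘ tangentCoords e =ᶠ[𝓝 x] Φ := by
    filter_upwards [(FiberBundle.continuous_proj (Coord m k)
      (TangentSpace 𝓘(ℝ, Coord m k) : Q → Type _)).continuousAt.eventually_mem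
        (e.open_source.mem_nhds hxe)] with v hv
    exact congrArg Φ (ofTangentCoords_tangentCoords he hv)
  have h := mfderiv_comp x hF.mdifferentiableAt hτ
  rw [hev.mfderiv_eq, mfderiv_eq_fderiv] at h
  exact DFunLike.congr_fun h ξ

/-- A linear map that preserves the dimension of a subspace is injective on it. -/
theorem eq_zero_of_finrank_eq_finrank_map {V W : Type*} [AddCommGroup V] [Module ℝ V]
    [FiniteDimensional ℝ V] [AddCommGroup W] [Module ℝ W] {S : V →ₗ[ℝ] W} {A : Submodule ℝ V}
    (h : Module.finrank ℝ A = Module.finrank ℝ (A.map S)) {θ : V} (hθ : θ ∈ A) (h0 : S θ = 0) :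
    θ = 0 := by
  have h1 := (S.domRestrict A).finrank_range_add_finrank_ker
  rw [LinearMap.range_domRestrict, ← h] at h1
  have h2 : LinearMap.ker (S.domRestrict A) = ⊥ := Submodule.finrank_eq_zero.1 (by omega)
  have h3 : (⟨θ, hθ⟩ : A) ∈ LinearMap.ker (S.domRestrict A) := h0
  rw [h2, Submodule.mem_bot] at h3
  exact congrArg Subtype.val h3

/-- Admissibility says that the velocity derivative of the constraints is surjective. -/
theorem surjective_fderiv_of_admissible
    (he : e ∈ IsManifold.maximalAtlas 𝓘(ℝ, Coord m k) ∞ Q) (hxe : x.proj ∈ e.source)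
    (hU : IsOpen U) (hΦ : ContMDiffOn (𝓘(ℝ, Coord m k)).tangent 𝓘(ℝ, Fin m → ℝ) ∞ Φ U)
    (hM : ∀ y ∈ U, y ∈ M ↔ Φ y = 0) (hx : x ∈ U)
    (hsurj : Function.Surjective (mfderiv (𝓘(ℝ, Coord m k)).tangent 𝓘(ℝ, Fin m → ℝ) Φ x))
    (hadm : Module.finrank ℝ (annihilator M x) =
      Module.finrank ℝ ((annihilator M x).map ((verticalEndo x).toLinearMap.dualMap))) :
    Function.Surjective fun u : Coord m k =>
      fderiv ℝ (Φ ∘ ofTangentCoords e) (tangentCoords e x) (0, u) := by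
  have hΦx := hΦ.contMDiffAt (hU.mem_nhds hx)
  have hV : FiniteDimensional ℝ (TangentSpace (𝓘(ℝ, Coord m k)).tangent x) :=
    inferInstanceAs (FiniteDimensional ℝ (Coord m k × Coord m k))
  set T : Coord m k →ₗ[ℝ] (Fin m → ℝ) :=
    (fderiv ℝ (Φ ∘ ofTangentCoords e) (tangentCoords e x)).toLinearMap ∘ₗ
      LinearMap.inr ℝ (Coord m k) (Coord m k) with hT
  suffices LinearMap.range T = ⊤ from LinearMap.range_eq_top.1 this
  by_contra hne
  -- If ∂Φ/∂q̇ is not surjective, a nonzero functional `l` vanishes on its range.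
  obtain ⟨l, hl, hlT⟩ := Submodule.exists_le_ker_of_lt_top _ (lt_top_iff_ne_top.2 hne)
  set dΦ : TangentSpace (𝓘(ℝ, Coord m k)).tangent x →ₗ[ℝ] (Fin m → ℝ) :=
    (mfderiv (𝓘(ℝ, Coord m k)).tangent 𝓘(ℝ, Fin m → ℝ) Φ x).toLinearMap with hdΦ
  -- Φ vanishes along every curve in M near x, so dΦ kills the tangent vectors. Only this inclusion
  -- is needed, not a description of the whole annihilator.
  have hmem : l ∘ₗ dΦ ∈ annihilator M x := by
    rw [annihilator, Submodule.mem_dualAnnihilator]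
    intro ξ hξ
    have hle : Submodule.span ℝ (tangentVectors (𝓘(ℝ, Coord m k)).tangent M x) ≤
        LinearMap.ker dΦ := by
      rw [Submodule.span_le]
      rintro ζ ⟨γ, hγ, hS, h⟩
      have h1 := hasDerivAt_comp_of_velocity_eq (hγ.mdifferentiableAt (by simp)) h
        (hΦx.mdifferentiableAt (by simp))
      have h0 : γ 0 = x := congrArg (fun v => v.proj) h
      have hev : Φ ∘ γ =ᶠ[𝓝 0] fun _ => 0 := by
        filter_upwards [hS, hγ.continuousAt.eventually_mem (hU.mem_nhds (by rw [h0]; exact hx))]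
          with t ht ht'
        exact (hM _ ht').1 ht
      exact h1.unique ((hasDerivAt_const (0 : ℝ) (0 : Fin m → ℝ)).congr_of_eventuallyEq hev)
    have : dΦ ξ = 0 := hle hξ
    simp [this]
  -- The image of S is vertical, where dΦ acts as ∂Φ/∂q̇, so S*(l ∘ dΦ) = 0; admissibility makes S*
  -- injective on the annihilator.
  have hzero : l ∘ₗ dΦ = 0 := by
    refine eq_zero_of_finrank_eq_finrank_map (S := (verticalEndo x).toLinearMap.dualMap) hadm hmem
      (LinearMap.ext fun ξ => ?_)
    have h2 := mfderiv_eq_fderiv_tangentCoords he hxe hΦx (verticalEndo x ξ)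
    rw [mfderiv_tangentCoords_verticalEndo he hxe] at h2
    have h3 : dΦ (verticalEndo x ξ) = T _ := h2
    change l (dΦ (verticalEndo x ξ)) = 0
    rw [h3]
    exact hlT (LinearMap.mem_range_self T _)
  refine hl (LinearMap.ext fun s => ?_)
  obtain ⟨ξ, rfl⟩ := hsurj s
  exact LinearMap.congr_fun hzero ξ

/-- A chart composed with a linear change of coordinates. -/
theorem transHomeomorph_mem_maximalAtlas
    (he : e ∈ IsManifold.maximalAtlas 𝓘(ℝ, Coord m k) ∞ Q) (A : Coord m k ≃L[ℝ] Coord m k) :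
    e.transHomeomorph A.toHomeomorph ∈ IsManifold.maximalAtlas 𝓘(ℝ, Coord m k) ∞ Q :=
  OpenPartialHomeomorph.mem_maximalAtlas_of_contMDiffOn _
    (A.contDiff.contMDiff.comp_contMDiffOn (contMDiffOn_of_mem_maximalAtlas he))
    ((contMDiffOn_symm_of_mem_maximalAtlas he).comp A.symm.contDiff.contMDiff.contMDiffOn
      fun _ h => h)

/-- Admissible submanifolds have constraint charts. -/
theorem exists_constraintChart (hMs : IsSubmanifoldOfCodim (𝓘(ℝ, Coord m k)).tangent m M)
    (hadm : IsAdmissible M) (hx : x ∈ M) : ∃ C : ConstraintChart M, x ∈ C.U := by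
  obtain ⟨U, hU, hxU, Φ, hΦ, hM, hsurj⟩ := hMs x hx
  set e := chartAt (Coord m k) x.proj with he_def
  have he : e ∈ IsManifold.maximalAtlas 𝓘(ℝ, Coord m k) ∞ Q := IsManifold.chart_mem_maximalAtlas _
  have hxe : x.proj ∈ e.source := mem_chart_source _ _
  obtain ⟨A, hA⟩ := exists_equiv_boundL_eq (T := (fderiv ℝ (Φ ∘ ofTangentCoords e)
    (tangentCoords e x)).comp (ContinuousLinearMap.inr ℝ _ _))
    (surjective_fderiv_of_admissible he hxe hU hΦ hM hxU (hsurj x hxU hx) (hadm x hx))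
  have he' := transHomeomorph_mem_maximalAtlas he A
  set e' := e.transHomeomorph A.toHomeomorph with he'_def
  have hxe' : x.proj ∈ e'.source := hxe
  refine exists_constraintChart_of_fderiv he' hU hΦ hM hxU hxe' fun u => ?_
  -- `B` is the change from the coordinates of `e'` to those of `e`. In the coordinates of `e'` the
  -- velocity derivative is T ∘ A⁻¹ = `boundL`.
  set B : Coord m k × Coord m k →L[ℝ] Coord m k × Coord m k :=
    (A.symm : Coord m k →L[ℝ] Coord m k).prodMap (A.symm : Coord m k →L[ℝ] Coord m k) with hB
  have hxy : B (tangentCoords e' x) = tangentCoords e x := by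
    have h1 := ofTangentCoords_tangentCoords he' hxe'
    rw [ofTangentCoords_transHomeomorph he A (y := tangentCoords e' x)
      (show A.symm (tangentCoords e' x).1 ∈ e.target from e'.map_source hxe')] at h1
    have h2 := tangentCoords_ofTangentCoords he (y := B (tangentCoords e' x)) (e'.map_source hxe')
    rw [← h2]
    exact congrArg (tangentCoords e) h1
  have hev : Φ ∘ ofTangentCoords e' =ᶠ[𝓝 (tangentCoords e' x)] (Φ ∘ ofTangentCoords e) ∘ B := by
    filter_upwards [continuousAt_fst.eventually_mem (e'.open_target.mem_nhds
      (show (tangentCoords e' x).1 ∈ e'.target from e'.map_source hxe'))] with y hy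
    exact congrArg Φ (ofTangentCoords_transHomeomorph he A hy)
  have hF : DifferentiableAt ℝ (Φ ∘ ofTangentCoords e) (B (tangentCoords e' x)) := by
    rw [hxy]
    have h1 : ContMDiffAt (𝓘(ℝ, Coord m k)).tangent 𝓘(ℝ, Fin m → ℝ) ∞ Φ
        (ofTangentCoords e (tangentCoords e x)) := by
      rw [ofTangentCoords_tangentCoords he hxe]
      exact hΦ.contMDiffAt (hU.mem_nhds hxU)
    exact (h1.comp (tangentCoords e x) (contMDiffAt_ofTangentCoords he
      (e.map_source hxe))).contDiffAt.differentiableAt (by simp)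
  rw [hev.fderiv_eq, fderiv_comp _ hF B.differentiableAt, hxy, B.fderiv]
  have h1 := hA (A.symm u)
  rw [A.apply_symm_apply] at h1
  rw [h1]
  simp [hB]

end Admissible

end Vakonomic

end

/-! ### The main theorem -/

theorem mainTheorem2 {m k : ℕ} {Q : Type*} [TopologicalSpace Q]
    [ChartedSpace (Coord m k) Q] [IsManifold 𝓘(ℝ, Coord m k) ∞ Q]
    (L : TangentBundle 𝓘(ℝ, Coord m k) Q → ℝ)
    (hL : ContMDiff (𝓘(ℝ, Coord m k)).tangent 𝓘(ℝ, ℝ) ∞ L)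
    (M : Set (TangentBundle 𝓘(ℝ, Coord m k) Q))
    (hM : IsSubmanifoldOfCodim (𝓘(ℝ, Coord m k)).tangent m M)
    (hadm : IsAdmissible M) :
    -- coordinates of the required form exist around every point of `M`
    (∀ x ∈ M, ∃ C : ConstraintChart M, x ∈ C.U) ∧
    -- the first constraint set, intrinsically
    (∀ w ∈ W₀ M, w ∈ W₁ L M ↔
      ∀ V ∈ kerForm M w, dHamiltonian L w V = 0) ∧
    ∀ C : ConstraintChart M,
      -- the first constraint set, in coordinates
      (∀ w ∈ W₀ M, pr₂ w ∈ C.U →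
        (w ∈ W₁ L M ↔ C.MomentumEquations L w)) ∧
      ∀ J : Set ℝ, J.OrdConnected → J.Nontrivial →
        -- integral curves are exactly the lifts to `W₁` of solutions of the vakonomic equations,
        -- with `p_α` as multipliers
        (∀ w : ℝ → WhitneySum (Coord m k) Q,
          (∀ t ∈ J, w t ∈ W₀ M ∧ pr₂ (w t) ∈ C.U) →
          (IsSolutionCurve L M J w ↔
            (∀ t ∈ J, pr₂ (w t) =
              velocity 𝓘(ℝ, Coord m k) (fun s => (w s).proj) J t) ∧
            (∀ t ∈ J, C.MomentumEquations L (w t)) ∧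
            C.VakonomicEquations L J (fun t => C.e (w t).proj)
              (fun t α => mom C.e (w t) (Fin.castAdd k α)))) ∧
        -- in particular for integral curves of a vector field that solves the equation along a
        -- subset `S` of `W₀`
        (∀ (S : Set (WhitneySum (Coord m k) Q))
          (X : ∀ w : WhitneySum (Coord m k) Q,
            TangentSpace (whitneyModel (Coord m k)) w)
          (w : ℝ → WhitneySum (Coord m k) Q),
          S ⊆ W₀ M → (∀ y ∈ S, SolvesAt L M y (X y)) →
          (∀ t ∈ J, w t ∈ S ∧ pr₂ (w t) ∈ C.U) → IsMIntegralCurveOn w X J →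
          (∀ t ∈ J, w t ∈ W₁ L M) ∧
          C.VakonomicEquations L J (fun t => C.e (w t).proj)
              (fun t α => mom C.e (w t) (Fin.castAdd k α))) ∧
        -- every solution of the vakonomic equations arises from exactly one integral curve
        (∀ (c : ℝ → Q) (μ : ℝ → Fin m → ℝ), (∀ t ∈ J, c t ∈ C.e.source) →
          C.VakonomicEquations L J (fun t => C.e (c t)) μ →
          ∃ w : ℝ → WhitneySum (Coord m k) Q,
            (IsSolutionCurve L M J w ∧ ∀ t ∈ J,
              pr₂ (w t) = velocity 𝓘(ℝ, Coord m k) c J t ∧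
              ∀ α, mom C.e (w t) (Fin.castAdd k α) = μ t α) ∧
            ∀ w' : ℝ → WhitneySum (Coord m k) Q,
              (IsSolutionCurve L M J w' ∧ ∀ t ∈ J,
                pr₂ (w' t) = velocity 𝓘(ℝ, Coord m k) c J t ∧
                ∀ α, mom C.e (w' t) (Fin.castAdd k α) = μ t α) →
              ∀ t ∈ J, w' t = w t) := by
  have hcharts : ∀ x ∈ M, ∃ C : ConstraintChart M, x ∈ C.U :=
    fun x hx => exists_constraintChart hM hadm hx
  refine ⟨hcharts, fun w hw => ?_, fun C => ⟨fun w hw hU => C.mem_W₁_iff hL hw hU,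
    fun J hJ hJ' => ?_⟩⟩
  · obtain ⟨C, hC⟩ := hcharts (pr₂ w) hw
    exact C.mem_W₁_iff_kerForm hL hw hC
  · have hu := uniqueDiffOn_of_ordConnected hJ hJ'
    refine ⟨fun w hw => C.isSolutionCurve_iff hL hu hw, fun S X w hS hX hw hwX => ?_,
      fun c μ hc h => C.exists_unique_isSolutionCurve hL hu hc h⟩
    have hsol : IsSolutionCurve L M J w := fun t ht => by
      refine ⟨hS (hw t ht).1, (hwX t ht).mdifferentiableWithinAt, ?_⟩
      -- Derivatives within `J` are unique, so the velocity is the value of the vector field and the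
      -- case of a field reduces to that of a solution curve.
      have hvel : mfderivWithin 𝓘(ℝ, ℝ) (whitneyModel (Coord m k)) w J t (1 : ℝ) = X (w t) :=
        (DFunLike.congr_fun ((hwX t ht).mfderivWithin (hu t ht).uniqueMDiffWithinAt) (1 : ℝ)).trans
          (one_smul ℝ (X (w t)))
      rw [hvel]
      exact hX _ (hw t ht).1
    exact ⟨fun t ht => ⟨(hsol t ht).1, _, (hsol t ht).2.2⟩,
      ((C.isSolutionCurve_iff hL hu fun t ht => ⟨hS (hw t ht).1, (hw t ht).2⟩).1 hsol).2.2⟩
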